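/- **Proposition (length distortion).** Let $\alpha>0$. The $\alpha$-Grushin plane $G^2_\alpha$ is $\mathbb R^2$ with the vector fields $X=\partial_x$ and $Y_\alpha=|x|^\alpha\partial_y$. The length of an absolutely continuous (in the Euclidean metric) curve $\gamma=(\gamma_1,\gamma_2):[a,b]\to\mathbb R^2$ is $$l(\gamma)=\int_a^b\sqrt{\gamma_1'(t)^2+\frac{\gamma_2'(t)^2}{|\gamma_1(t)|^{2\alpha}}}\;dt\in[0,\infty].$$ For an open set $\Omega\subset\mathbb R^2$ and $q\ge 1$, $HW^{1,q}(\Omega)$ is the set of $f\in L^q(\Omega)$ (Lebesgue measure) that have weak first partial derivatives and satisfy $Xf,\,Y_\alpha f\in L^q(\Omega)$. A map $g=(g_1,g_2):\Omega\to\Omega'$ is in $HW^{1,q}(\Omega,\Omega')$ if $g_1,g_2\in HW^{1,q}(\Omega)$, and in $HW^{1,q}_{\mathrm{loc}}(\Omega,\Omega')$ if $g\in HW^{1,q}(V,\Omega')$ for every open $V\subset\subset\Omega$, i.e. every open $V$ whose closure is compact and contained in $\Omega$. Let $g\in HW^{1,2}_{\mathrm{loc}}(\Omega,\Omega')$ be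 a homeomorphism of $\Omega$ onto $\Omega'$, and let $S_g=\{(x,y)\in\Omega: x=0\text{ or }g_1(x,y)=0\}$, $R_g=\Omega\setminus S_g$. Then $g$ is called *conformal* if the matrix $$D_\alpha g=\begin{bmatrix}Xg_1&Y_\alpha g_1\\ |g_1|^{-\alpha}Xg_2&|g_1|^{-\alpha}Y_\alpha g_2\end{bmatrix}$$ is a positive multiple of an orthogonal matrix at almost every point of $R_g$, and for every $p_0\in S_g$ the limit $\lim_{R_g\ni p\to p_0}D_\alpha g(p)$ exists, is finite and is not the zero matrix. A map $g\in HW^{1,1}_{\mathrm{loc}}(\Omega,\Omega')$ is *orientation preserving* if $Xg_1\,Y_\alpha g_2-Xg_2\,Y_\alpha g_1>0$ almost everywhere in $\Omega$. In the last two definitions $X$ and $Y_\alpha$ are taken with the classical partial derivatives. Let $\Omega,\Omega'\subset\mathbb R^2$ be open and connected, let $g\in HW^{1,\frac{2(\alpha+1)}{\alpha}}(\Omega,\Omega')$ be conformal and orientation preserving, and let $U\subset\subset\Omega$ (the closure of $U$ is compact and contained in $\Omega$). Then there are constants $C_1,C_2>0$, depending only on $g$ and $U$, such that for every curve $\gamma:[a,b]\to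 U$ that is absolutely continuous in the Euclidean metric and satisfies $\gamma'\ne 0$ a.e. in $(a,b)$ and $\gamma_1\neq 0$ a.e. in $[a,b]$, the curve $g\circ\gamma$ is absolutely continuous and $$C_1\,l(\gamma)\le l(g\circ\gamma)\le C_2\,l(\gamma).$$ -/

import Mathlib

open MeasureTheory Set Filter Topology

noncomputable section

namespace Grushin

/-- The classical partial derivative `∂f/∂x` (equal to `0` where it does not exist). -/
def partialX (f : ℝ × ℝ → ℝ) (p : ℝ × ℝ) : ℝ := deriv (fun s => f (s, p.2)) p.1

/-- The classical partial derivative `∂f/∂y` (equal to `0` where it does not exist). -/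
def partialY (f : ℝ × ℝ → ℝ) (p : ℝ × ℝ) : ℝ := deriv (fun s => f (p.1, s)) p.2

/-- The horizontal vector field `Y_α = |x|^α ∂_y` applied to `f`
(the other one is `X = ∂_x`, that is `partialX`). -/
def fieldY (α : ℝ) (f : ℝ × ℝ → ℝ) (p : ℝ × ℝ) : ℝ := |p.1| ^ α * partialY f p

/-- `U ⊂⊂ Ω`: the Euclidean closure of `U` is compact and contained in `Ω`. -/
def CompactlyContained (U Ω : Set (ℝ × ℝ)) : Prop := IsCompact (closure U) ∧ closure U ⊆ Ω

/-- Smooth test functions with compact support in `Ω`. -/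
def IsTestFunction (Ω : Set (ℝ × ℝ)) (φ : ℝ × ℝ → ℝ) : Prop :=
  ContDiff ℝ (⊤ : ℕ∞) φ ∧ HasCompactSupport φ ∧ tsupport φ ⊆ Ω

/-- `v` is the weak partial derivative `∂f/∂x` of `f` in `Ω`. -/
def HasWeakPartialX (Ω : Set (ℝ × ℝ)) (f v : ℝ × ℝ → ℝ) : Prop :=
  LocallyIntegrableOn f Ω ∧ LocallyIntegrableOn v Ω ∧
    ∀ φ : ℝ × ℝ → ℝ, IsTestFunction Ω φ →
      ∫ p in Ω, f p * partialX φ p = -∫ p in Ω, v p * φ p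

/-- `v` is the weak partial derivative `∂f/∂y` of `f` in `Ω`. -/
def HasWeakPartialY (Ω : Set (ℝ × ℝ)) (f v : ℝ × ℝ → ℝ) : Prop :=
  LocallyIntegrableOn f Ω ∧ LocallyIntegrableOn v Ω ∧
    ∀ φ : ℝ × ℝ → ℝ, IsTestFunction Ω φ →
      ∫ p in Ω, f p * partialY φ p = -∫ p in Ω, v p * φ p

/-- The horizontal Sobolev space `HW^{1,q}(Ω)` of the `α`-Grushin plane, with respect to Lebesgue
measure: `f ∈ L^q(Ω)` has weak first partial derivatives in `Ω`, and its horizontal gradient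
`(∂f/∂x, |x|^α ∂f/∂y)` is in `L^q(Ω)`. -/
def MemHW (α q : ℝ) (Ω : Set (ℝ × ℝ)) (f : ℝ × ℝ → ℝ) : Prop :=
  MemLp f (ENNReal.ofReal q) (volume.restrict Ω) ∧
    ∃ v w : ℝ × ℝ → ℝ, HasWeakPartialX Ω f v ∧ HasWeakPartialY Ω f w ∧
      MemLp v (ENNReal.ofReal q) (volume.restrict Ω) ∧
      MemLp (fun p => |p.1| ^ α * w p) (ENNReal.ofReal q) (volume.restrict Ω)

/-- The horizontal Sobolev space of mappings `HW^{1,q}(Ω, Ω')`. -/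
def MemHWMap (α q : ℝ) (Ω Ω' : Set (ℝ × ℝ)) (g : ℝ × ℝ → ℝ × ℝ) : Prop :=
  MapsTo g Ω Ω' ∧ MemHW α q Ω (fun p => (g p).1) ∧ MemHW α q Ω (fun p => (g p).2)

/-- The local horizontal Sobolev space of mappings `HW^{1,q}_loc(Ω, Ω')`. -/
def MemHWMapLoc (α q : ℝ) (Ω Ω' : Set (ℝ × ℝ)) (g : ℝ × ℝ → ℝ × ℝ) : Prop :=
  MapsTo g Ω Ω' ∧
    ∀ U : Set (ℝ × ℝ), IsOpen U → CompactlyContained U Ω → MemHWMap α q U Ω' g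

/-- The singular set `S_g = {(x, y) ∈ Ω | x = 0 or g₁(x, y) = 0}`. -/
def singularSet (Ω : Set (ℝ × ℝ)) (g : ℝ × ℝ → ℝ × ℝ) : Set (ℝ × ℝ) :=
  {p | p ∈ Ω ∧ (p.1 = 0 ∨ (g p).1 = 0)}

/-- The regular set `R_g = Ω \ S_g`. -/
def regularSet (Ω : Set (ℝ × ℝ)) (g : ℝ × ℝ → ℝ × ℝ) : Set (ℝ × ℝ) :=
  Ω \ singularSet Ω g

/-- The matrix `D_α g`, with rows `(X g₁, Y_α g₁)` and `(X g₂ / |g₁|^α, Y_α g₂ / |g₁|^α)`. -/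
def matrixD (α : ℝ) (g : ℝ × ℝ → ℝ × ℝ) (p : ℝ × ℝ) : Matrix (Fin 2) (Fin 2) ℝ :=
  !![partialX (fun z => (g z).1) p, fieldY α (fun z => (g z).1) p;
     partialX (fun z => (g z).2) p / |(g p).1| ^ α, fieldY α (fun z => (g z).2) p / |(g p).1| ^ α]

/-- The matrix `D_H g`, with rows `(X g₁, Y_α g₁)` and `(X g₂, Y_α g₂)`. -/
def matrixDH (α : ℝ) (g : ℝ × ℝ → ℝ × ℝ) (p : ℝ × ℝ) : Matrix (Fin 2) (Fin 2) ℝ :=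
  !![partialX (fun z => (g z).1) p, fieldY α (fun z => (g z).1) p;
     partialX (fun z => (g z).2) p, fieldY α (fun z => (g z).2) p]

/-- `g` restricts to a homeomorphism of `Ω` onto `Ω'`. -/
def IsHomeoBetween (Ω Ω' : Set (ℝ × ℝ)) (g : ℝ × ℝ → ℝ × ℝ) : Prop :=
  ∃ e : Ω ≃ₜ Ω', ∀ p : Ω, (e p : ℝ × ℝ) = g p

/-- `g : Ω → Ω'` is conformal in the `α`-Grushin plane: it is a homeomorphism in
`HW^{1,2}_loc(Ω, Ω')`; `D_α g` is a positive multiple of an orthogonal matrix almost everywhere in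
`R_g`; and at every point of `S_g` the limit of `D_α g` along `R_g` exists, is finite and is not
the zero matrix. -/
structure IsConformal (α : ℝ) (Ω Ω' : Set (ℝ × ℝ)) (g : ℝ × ℝ → ℝ × ℝ) : Prop where
  memHW : MemHWMapLoc α 2 Ω Ω' g
  homeo : IsHomeoBetween Ω Ω' g
  conformal_ae : ∀ᵐ p : ℝ × ℝ, p ∈ regularSet Ω g →
    ∃ c : ℝ, 0 < c ∧ ∃ Q ∈ Matrix.orthogonalGroup (Fin 2) ℝ, matrixD α g p = c • Q
  limit : ∀ p₀ ∈ singularSet Ω g, ∃ L : Matrix (Fin 2) (Fin 2) ℝ, L ≠ 0 ∧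
    Tendsto (matrixD α g) (𝓝[regularSet Ω g] p₀) (𝓝 L)

/-- `g ∈ HW^{1,1}_loc(Ω, Ω')` is orientation preserving: `det D_H g > 0` almost everywhere
in `Ω`. -/
def OrientationPreserving (α : ℝ) (Ω Ω' : Set (ℝ × ℝ)) (g : ℝ × ℝ → ℝ × ℝ) : Prop :=
  MemHWMapLoc α 1 Ω Ω' g ∧ ∀ᵐ p : ℝ × ℝ, p ∈ Ω → 0 < (matrixDH α g p).det

/-- The Grushin speed `√(x'² + y'² / |x|^{2α}) ∈ [0, ∞]` of the curve `γ = (x, y)` at time `t`.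
If `x = 0`, it is infinite for `y' ≠ 0` and equal to `|x'|` for `y' = 0`. -/
def speed (α : ℝ) (γ : ℝ → ℝ × ℝ) (t : ℝ) : ENNReal :=
  (ENNReal.ofReal ((deriv γ t).1 ^ 2) +
    ENNReal.ofReal ((deriv γ t).2 ^ 2) / ENNReal.ofReal (|(γ t).1| ^ (2 * α))) ^ (1 / 2 : ℝ)

/-- The length, in `[0, ∞]`, in the `α`-Grushin plane of the absolutely continuous curve
`γ : [a, b] → ℝ²`. -/
def length (α a b : ℝ) (γ : ℝ → ℝ × ℝ) : ENNReal := ∫⁻ t in Icc a b, speed α γ t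

end Grushin

end

open scoped Interval

/-! In the coordinate `toComplex`, that is s + iy with s = x|x|^α/(α+1) and ds = |x|^α dx, the
Grushin metric dx² + dy²/|x|^{2α} is |x|^{-2α}(ds² + dy²). It is thus conformal to the Euclidean
metric off the line x = 0. Let F be g read in this coordinate (`complexConj`). Conformality and
orientation give the Cauchy–Riemann equations for F, up to the factor |x|^α, almost everywhere. A
continuous Sobolev function is absolutely continuous on almost every line, so Fubini turns these
equations into vanishing integrals of F over boundaries of rectangles, even of those that meet the
singular line. By Morera F is holomorphic (`differentiableOn_complexConj`); being injective, it has
F' ≠ 0.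

Where g₁ ≠ 0, `matrixD_eq` gives D_α g = (|x|/|g₁|)^α F', with F' acting on the plane by
multiplication. So g scales Grushin speed by λ = (|x|/|g₁|)^α |F'| (`speed_comp`). On R_g, λ is
continuous and positive. At S_g the limit condition makes λ tend to a positive number. Compactness
of the closure of U then bounds λ from above and away from 0, and integrating the speeds gives both
length estimates.

Absolute continuity of g ∘ γ follows from g being locally Lipschitz. The only doubtful derivative is
∂_y g₁ = -Im F'/|g₁|^α near x = 0. The relation λ|g₁|^α = |x|^α|F'| shows that x = 0 exactly when g₁
= 0, so F preserves the imaginary axis and Im F' = 0 there. Hence |Im F'| ≤ K|x||x|^α, while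
|x|^α/|g₁|^α stays bounded. -/

/-! ### Injective holomorphic functions. -/

theorem Complex.deriv_ne_zero_of_injOn {f : ℂ → ℂ} {U : Set ℂ} (hU : IsOpen U)
    (hf : DifferentiableOn ℂ f U) (hinj : InjOn f U) {z : ℂ} (hz : z ∈ U) : deriv f z ≠ 0 := by
  have han : AnalyticOnNhd ℂ f U := hf.analyticOnNhd hU
  -- The open mapping alternative: injectivity excludes local constancy.
  have hopen : ∀ w ∈ U, 𝓝 (f w) ≤ map f (𝓝 w) := by
    intro w hw
    refine (han w hw).eventually_constant_or_nhds_le_map_nhds.resolve_left fun hc => ?_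
    have h1 : ∀ᶠ y in 𝓝 w, y = w := by
      filter_upwards [hc, hU.mem_nhds hw] with y hy hyU using hinj hyU hw hy
    have h2 : ∀ᶠ y in 𝓝[≠] w, False := by
      filter_upwards [h1.filter_mono nhdsWithin_le_nhds, self_mem_nhdsWithin]
        with y hy hy' using hy' hy
    exact h2.exists.elim fun _ h => h
  set h := Function.invFunOn f U with hh
  have hhf : ∀ w ∈ U, h (f w) = w := fun w hw => hinj.leftInvOn_invFunOn hw
  have hfh : ∀ w ∈ U, ∀ᶠ y in 𝓝 (f w), f (h y) = y := by
    intro w hw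
    have : f '' U ∈ 𝓝 (f w) := hopen w hw (image_mem_map (hU.mem_nhds hw))
    filter_upwards [this]
    rintro _ ⟨x, hx, rfl⟩
    rw [hhf x hx]
  have hcont : ∀ w ∈ U, ContinuousAt h (f w) := by
    intro w hw N hN
    rw [hhf w hw] at hN
    rw [mem_map]
    have : f '' (N ∩ U) ∈ 𝓝 (f w) :=
      hopen w hw (image_mem_map (inter_mem hN (hU.mem_nhds hw)))
    filter_upwards [this]
    rintro _ ⟨x, ⟨hxN, hx⟩, rfl⟩
    simpa only [mem_preimage, hhf x hx] using hxN
  have hdiff : ∀ w ∈ U, deriv f w ≠ 0 → DifferentiableAt ℂ h (f w) := by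
    intro w hw hd
    have h1 : HasDerivAt f (deriv f w) (h (f w)) := by
      rw [hhf w hw]; exact (han w hw).differentiableAt.hasDerivAt
    exact (HasDerivAt.of_local_left_inverse (hcont w hw) h1 hd (hfh w hw)).differentiableAt
  -- Zeros of f' are isolated, since otherwise f would be constant on a ball.
  have hpunct : ∀ᶠ w in 𝓝[≠] z, deriv f w ≠ 0 := by
    refine ((han z hz).deriv.eventually_eq_zero_or_eventually_ne_zero).resolve_left fun hc => ?_
    obtain ⟨r, hr, hball⟩ := Metric.eventually_nhds_iff_ball.1 (hc.and (hU.mem_nhds hz))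
    have hconst : ∀ w ∈ Metric.ball z r, f w = f z := by
      intro w hw
      refine Metric.isOpen_ball.is_const_of_deriv_eq_zero (convex_ball z r).isPreconnected
        (hf.mono fun y hy => (hball y hy).2) (fun y hy => (hball y hy).1) hw
        (Metric.mem_ball_self hr)
    have h2 : ∀ᶠ y in 𝓝[≠] z, False := by
      filter_upwards [nhdsWithin_le_nhds (Metric.ball_mem_nhds z hr), self_mem_nhdsWithin]
        with y hy hy'
      exact hy' (hinj (hball y hy).2 hz (hconst y hy))
    exact h2.exists.elim fun _ h => h
  -- The inverse is holomorphic on a punctured neighbourhood of f z and continuous at f z, so the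
  -- singularity is removable. The chain rule for h ∘ f = id then forbids f' z = 0.
  have hdz : DifferentiableAt ℂ h (f z) := by
    refine (Complex.analyticAt_of_differentiable_on_punctured_nhds_of_continuousAt ?_
      (hcont z hz)).differentiableAt
    obtain ⟨N, hN, hN'⟩ := mem_nhdsWithin_iff_exists_mem_nhds_inter.1 hpunct
    have : f '' (N ∩ U) ∈ 𝓝 (f z) :=
      hopen z hz (image_mem_map (inter_mem hN (hU.mem_nhds hz)))
    filter_upwards [nhdsWithin_le_nhds this, self_mem_nhdsWithin]
    rintro _ ⟨x, ⟨hxN, hx⟩, rfl⟩ hne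
    refine hdiff x hx (hN' ⟨hxN, fun hxz => hne ?_⟩)
    rw [mem_singleton_iff] at hxz ⊢
    rw [hxz]
  have hcomp : HasDerivAt (h ∘ f) (deriv h (f z) * deriv f z) z :=
    hdz.hasDerivAt.comp z (han z hz).differentiableAt.hasDerivAt
  have hid : HasDerivAt (h ∘ f) 1 z := by
    refine (hasDerivAt_id z).congr_of_eventuallyEq ?_
    filter_upwards [hU.mem_nhds hz] with w hw using hhf w hw
  intro h0
  have := hcomp.unique hid
  simp [h0] at this

/-! ### The flattening coordinate. -/

namespace Grushin

/-- The primitive `x |x|^α / (α + 1)` of `|x|^α`. -/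
noncomputable def flatten (α x : ℝ) : ℝ := x * |x| ^ α / (α + 1)

variable {α : ℝ}

theorem continuous_abs_rpow (hα : 0 < α) : Continuous fun x : ℝ => |x| ^ α :=
  continuous_abs.rpow_const fun _ => Or.inr hα.le

theorem hasDerivAt_flatten (hα : 0 < α) (x : ℝ) : HasDerivAt (flatten α) (|x| ^ α) x := by
  have key : ∀ t : ℝ, 0 < t → HasDerivAt (fun s : ℝ => s * s ^ α / (α + 1)) (t ^ α) t := by
    intro t ht
    have h1 := ((hasDerivAt_id t).mul (Real.hasDerivAt_rpow_const (p := α) (Or.inl ht.ne'))).div_const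
      (α + 1)
    refine h1.congr_deriv ?_
    have : t * t ^ (α - 1) = t ^ α := by
      rw [Real.rpow_sub_one ht.ne']; field_simp
    simp only [id]
    field_simp
    linear_combination α * this
  rcases lt_trichotomy x 0 with hx | rfl | hx
  · have h1 := (key (-x) (neg_pos.2 hx)).scomp x (hasDerivAt_neg x)
    have h2 := h1.neg
    simp only [smul_eq_mul, neg_mul, one_mul, neg_neg] at h2
    rw [abs_of_neg hx]
    refine h2.congr_of_eventuallyEq ?_
    filter_upwards [Iio_mem_nhds hx] with s hs
    simp [flatten, abs_of_neg (show s < 0 from hs)]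
    ring
  · rw [abs_zero, Real.zero_rpow hα.ne', hasDerivAt_iff_tendsto_slope]
    -- This is the slope of `flatten α` between 0 and s.
    have h1 : Tendsto (fun s : ℝ => |s| ^ α / (α + 1)) (𝓝[≠] 0) (𝓝 0) := by
      have := ((continuous_abs_rpow hα).div_const (α + 1)).tendsto 0
      simp only [abs_zero, Real.zero_rpow hα.ne', zero_div] at this
      exact this.mono_left nhdsWithin_le_nhds
    refine h1.congr' ?_
    filter_upwards [self_mem_nhdsWithin] with s hs
    have hs : s ≠ 0 := hs
    simp only [slope, flatten, vsub_eq_sub, sub_zero, zero_mul, zero_div, smul_eq_mul]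
    field_simp
  · rw [abs_of_pos hx]
    refine (key x hx).congr_of_eventuallyEq ?_
    filter_upwards [Ioi_mem_nhds hx] with s hs
    simp [flatten, abs_of_pos (show 0 < s from hs)]

theorem hasStrictDerivAt_flatten (hα : 0 < α) (x : ℝ) :
    HasStrictDerivAt (flatten α) (|x| ^ α) x :=
  hasStrictDerivAt_of_hasDerivAt_of_continuousAt (.of_forall fun y => hasDerivAt_flatten hα y)
    (continuous_abs_rpow hα).continuousAt

theorem continuous_flatten (hα : 0 < α) : Continuous (flatten α) :=
  continuous_iff_continuousAt.2 fun x => (hasDerivAt_flatten hα x).continuousAt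

theorem flatten_zero (α : ℝ) : flatten α 0 = 0 := by simp [flatten]

theorem abs_flatten_le (hα : 0 < α) (x : ℝ) : |flatten α x| ≤ |x| * |x| ^ α := by
  rw [flatten, abs_div, abs_mul, abs_of_nonneg (Real.rpow_nonneg (abs_nonneg x) α),
    abs_of_pos (by linarith : 0 < α + 1)]
  exact div_le_self (by positivity) (by linarith)

theorem strictMono_flatten (hα : 0 < α) : StrictMono (flatten α) := by
  have hpos : StrictMonoOn (flatten α) (Ici 0) := by
    refine strictMonoOn_of_deriv_pos (convex_Ici 0) (continuous_flatten hα).continuousOn ?_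
    intro x hx
    rw [interior_Ici] at hx
    rw [(hasDerivAt_flatten hα x).deriv]
    exact Real.rpow_pos_of_pos (abs_pos.2 (ne_of_gt hx)) _
  have hneg : StrictMonoOn (flatten α) (Iic 0) := by
    refine strictMonoOn_of_deriv_pos (convex_Iic 0) (continuous_flatten hα).continuousOn ?_
    intro x hx
    rw [interior_Iic] at hx
    rw [(hasDerivAt_flatten hα x).deriv]
    exact Real.rpow_pos_of_pos (abs_pos.2 (ne_of_lt hx)) _
  exact hneg.Iic_union_Ici hpos

theorem surjective_flatten (hα : 0 < α) : Function.Surjective (flatten α) := by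
  have htop : Tendsto (flatten α) atTop atTop := by
    have h1 : Tendsto (fun x : ℝ => x * x ^ α) atTop atTop :=
      tendsto_id.atTop_mul_atTop₀ (tendsto_rpow_atTop hα)
    refine (h1.atTop_div_const (by linarith : 0 < α + 1)).congr' ?_
    filter_upwards [eventually_ge_atTop 0] with x hx
    simp [flatten, abs_of_nonneg hx]
  have hodd : ∀ x, flatten α (-x) = -flatten α x := fun x => by simp [flatten]; ring
  refine (continuous_flatten hα).surjective htop ?_
  have := tendsto_neg_atTop_atBot.comp (htop.comp tendsto_neg_atBot_atTop)
  refine this.congr fun x => ?_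
  simp [hodd]

/-- `flatten α` as a homeomorphism of the line. -/
noncomputable def flattenHomeo (hα : 0 < α) : ℝ ≃ₜ ℝ :=
  ((strictMono_flatten hα).orderIsoOfSurjective _ (surjective_flatten hα)).toHomeomorph

theorem flattenHomeo_apply (hα : 0 < α) (x : ℝ) : flattenHomeo hα x = flatten α x := rfl

theorem flatten_flattenHomeo_symm (hα : 0 < α) (z : ℝ) :
    flatten α ((flattenHomeo hα).symm z) = z := (flattenHomeo hα).apply_symm_apply z

theorem hasStrictDerivAt_flattenHomeo_symm (hα : 0 < α) {x : ℝ} (hx : x ≠ 0) :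
    HasStrictDerivAt (flattenHomeo hα).symm (|x| ^ α)⁻¹ (flatten α x) := by
  have hs : (flattenHomeo hα).symm (flatten α x) = x := (flattenHomeo hα).symm_apply_apply x
  refine HasStrictDerivAt.of_local_left_inverse (f := flatten α)
    (flattenHomeo hα).symm.continuous.continuousAt ?_ ?_
    (.of_forall fun y => flatten_flattenHomeo_symm hα y)
  · rw [hs]; exact hasStrictDerivAt_flatten hα x
  · exact (Real.rpow_pos_of_pos (abs_pos.2 hx) _).ne'

/-- The homeomorphism `(x, y) ↦ flatten α x + i y` of the Grushin plane with `ℂ`, which is conformal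
off the singular line. -/
noncomputable def toComplex (hα : 0 < α) : ℝ × ℝ ≃ₜ ℂ :=
  ((flattenHomeo hα).prodCongr (Homeomorph.refl ℝ)).trans
    Complex.equivRealProdCLM.symm.toHomeomorph

theorem toComplex_apply (hα : 0 < α) (p : ℝ × ℝ) :
    toComplex hα p = (⟨flatten α p.1, p.2⟩ : ℂ) := by
  apply Complex.ext <;> simp [toComplex, flattenHomeo_apply]

end Grushin

/-! ### Smooth cutoffs approximating an interval. -/

theorem Real.deriv_smoothTransition_of_one_lt {t : ℝ} (ht : 1 < t) :
    deriv Real.smoothTransition t = 0 := by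
  have : Real.smoothTransition =ᶠ[𝓝 t] fun _ => 1 := by
    filter_upwards [Ioi_mem_nhds ht] with s hs
    exact Real.smoothTransition.one_of_one_le (le_of_lt hs)
  rw [this.deriv_eq, deriv_const]

/-- The kernel k S'(k(x - a)) has mass one and lives on [a, a + 1/k], which `hk1` keeps inside [a,
b]. Substituting x = a + t/k reduces the claim to continuity in the parameter 1/k. -/
theorem Real.tendsto_integral_mul_deriv_smoothTransition {h : ℝ → ℝ} (hh : Continuous h)
    {a b : ℝ} {k : ℕ → ℝ} (hk : Tendsto k atTop atTop) (hk1 : ∀ n, 1 ≤ k n * (b - a)) :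
    Tendsto (fun n => ∫ x in a..b, h x * (k n * deriv Real.smoothTransition (k n * (x - a))))
      atTop (𝓝 (h a)) := by
  have hS : Continuous (deriv Real.smoothTransition) :=
    (Real.smoothTransition.contDiff (n := 1)).continuous_deriv le_rfl
  have hsub : ∀ᶠ n in atTop, ∫ t in (0 : ℝ)..1, h (a + (k n)⁻¹ * t) * deriv Real.smoothTransition t
      = ∫ x in a..b, h x * (k n * deriv Real.smoothTransition (k n * (x - a))) := by
    filter_upwards [hk.eventually_gt_atTop 0] with n hn
    have h1 : ∀ x, h x * (k n * deriv Real.smoothTransition (k n * (x - a)))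
        = (fun t => k n * (h (a + (k n)⁻¹ * t) * deriv Real.smoothTransition t))
          (k n * x - k n * a) := by
      intro x
      have e : a + (k n)⁻¹ * (k n * x - k n * a) = x := by field_simp; ring
      simp only [e]
      rw [mul_sub]; ring
    rw [intervalIntegral.integral_congr fun x _ => h1 x,
      intervalIntegral.integral_comp_mul_sub
        (fun t => k n * (h (a + (k n)⁻¹ * t) * deriv Real.smoothTransition t)) hn.ne',
      intervalIntegral.integral_const_mul,
      smul_eq_mul, ← mul_assoc, inv_mul_cancel₀ hn.ne', one_mul, sub_self, ← mul_sub]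
    have hc : Continuous fun t => h (a + (k n)⁻¹ * t) * deriv Real.smoothTransition t := by fun_prop
    rw [← intervalIntegral.integral_add_adjacent_intervals (hc.intervalIntegrable 0 1)
      (hc.intervalIntegrable 1 (k n * (b - a)))]
    have : ∫ t in (1 : ℝ)..k n * (b - a), h (a + (k n)⁻¹ * t) * deriv Real.smoothTransition t = 0 := by
      rw [intervalIntegral.integral_of_le (hk1 n)]
      refine setIntegral_eq_zero_of_forall_eq_zero fun t ht => ?_
      rw [Real.deriv_smoothTransition_of_one_lt ht.1, mul_zero]
    rw [this, add_zero]
  refine Tendsto.congr' hsub ?_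
  have hc : Continuous fun s : ℝ =>
      ∫ t in (0 : ℝ)..1, h (a + s * t) * deriv Real.smoothTransition t := by
    apply intervalIntegral.continuous_parametric_intervalIntegral_of_continuous'
    fun_prop
  have h0 : ∫ t in (0 : ℝ)..1, h (a + 0 * t) * deriv Real.smoothTransition t = h a := by
    simp only [zero_mul, add_zero, intervalIntegral.integral_const_mul]
    rw [intervalIntegral.integral_deriv_eq_sub
      (fun x _ => ((Real.smoothTransition.contDiff (n := 1)).differentiable one_ne_zero) x)
      (hS.intervalIntegrable _ _)]
    simp
  have := (hc.tendsto 0).comp (tendsto_inv_atTop_zero.comp hk)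
  rw [h0] at this
  exact this

/-- Smooth functions supported in `[a, b]` that approximate the indicator function of `[a, b]`. -/
theorem exists_smooth_tendsto_indicator {a b : ℝ} (hab : a < b) :
    ∃ ψ : ℕ → ℝ → ℝ, (∀ n, ContDiff ℝ (⊤ : ℕ∞) (ψ n)) ∧ (∀ n, ∀ x ∉ Icc a b, ψ n x = 0) ∧
      (∀ h : ℝ → ℝ, ContinuousOn h (Icc a b) →
        Tendsto (fun n => ∫ x in a..b, h x * deriv (ψ n) x) atTop (𝓝 (h a - h b))) ∧
      (∀ v : ℝ → ℝ, IntervalIntegrable v volume a b →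
        Tendsto (fun n => ∫ x in a..b, v x * ψ n x) atTop (𝓝 (∫ x in a..b, v x))) := by
  have hba : 0 < b - a := sub_pos.2 hab
  -- The summand (b - a)⁻¹ gives k n (b - a) ≥ 1 for every n, including n = 0. To the left of a, or
  -- to the right of b, one transition is then 0 and the other is 1.
  set k : ℕ → ℝ := fun n => n + (b - a)⁻¹ with hk
  have hk0 : ∀ n, 0 < k n := fun n => by positivity
  have hk1 : ∀ n, 1 ≤ k n * (b - a) := fun n => by
    rw [hk]; simp only
    rw [add_mul, inv_mul_cancel₀ hba.ne']
    have : 0 ≤ (n : ℝ) * (b - a) := by positivity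
    linarith
  have hkt : Tendsto k atTop atTop :=
    tendsto_atTop_add_const_right _ _ tendsto_natCast_atTop_atTop
  have hS : ∀ m : ℕ∞, ContDiff ℝ m Real.smoothTransition := fun _ => Real.smoothTransition.contDiff
  have hSd : Differentiable ℝ Real.smoothTransition := (hS 1).differentiable one_ne_zero
  have hSc : Continuous (deriv Real.smoothTransition) := (hS 1).continuous_deriv le_rfl
  refine ⟨fun n x => Real.smoothTransition (k n * (x - a)) +
    Real.smoothTransition (k n * (b - x)) - 1, fun n => ?_, fun n x hx => ?_, fun h hh => ?_,
    fun v hv => ?_⟩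
  · exact (((hS ⊤).comp (contDiff_const.mul (contDiff_id.sub contDiff_const))).add
      ((hS ⊤).comp (contDiff_const.mul (contDiff_const.sub contDiff_id)))).sub contDiff_const
  · rw [mem_Icc, not_and_or, not_le, not_le] at hx
    simp only
    rcases hx with hx | hx
    · rw [Real.smoothTransition.zero_of_nonpos (x := k n * (x - a))
        (mul_nonpos_of_nonneg_of_nonpos (hk0 n).le (by linarith)),
        Real.smoothTransition.one_of_one_le
        ((hk1 n).trans (mul_le_mul_of_nonneg_left (by linarith) (hk0 n).le))]
      ring
    · rw [Real.smoothTransition.zero_of_nonpos (x := k n * (b - x))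
        (mul_nonpos_of_nonneg_of_nonpos (hk0 n).le (by linarith)),
        Real.smoothTransition.one_of_one_le
        ((hk1 n).trans (mul_le_mul_of_nonneg_left (by linarith) (hk0 n).le))]
      ring
  -- The one-sided limit lemma wants a globally continuous function, so h is extended by constants.
  · set H : ℝ → ℝ := IccExtend hab.le ((Icc a b).domRestrict h) with hH
    have hHc : Continuous H := (continuousOn_iff_continuous_domRestrict.1 hh).Icc_extend'
    have hHe : ∀ x ∈ Icc a b, H x = h x := fun x hx => by
      rw [hH, IccExtend_of_mem _ _ hx]; rfl
    have hd : ∀ n x, HasDerivAt (fun x => Real.smoothTransition (k n * (x - a)) +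
        Real.smoothTransition (k n * (b - x)) - 1)
        (k n * deriv Real.smoothTransition (k n * (x - a)) -
          k n * deriv Real.smoothTransition (k n * (b - x))) x := by
      intro n x
      have h1 := (hSd (k n * (x - a))).hasDerivAt.comp x
        (((hasDerivAt_id x).sub_const a).const_mul (k n))
      have h2 := (hSd (k n * (b - x))).hasDerivAt.comp x
        (((hasDerivAt_id x).const_sub b).const_mul (k n))
      refine ((h1.add h2).sub_const 1).congr_deriv ?_
      ring
    -- The derivative is an approximation of δ_a - δ_b. Reflecting x to -x turns the right endpoint
    -- b into the left endpoint -b.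
    have e1 : ∀ n, ∫ x in a..b, h x * deriv (fun x => Real.smoothTransition (k n * (x - a)) +
        Real.smoothTransition (k n * (b - x)) - 1) x =
        (∫ x in a..b, H x * (k n * deriv Real.smoothTransition (k n * (x - a)))) -
        ∫ x in -b..-a, H (-x) * (k n * deriv Real.smoothTransition (k n * (x - -b))) := by
      intro n
      have e2 := intervalIntegral.integral_comp_neg (a := a) (b := b)
        (fun x => H (-x) * (k n * deriv Real.smoothTransition (k n * (x - -b))))
      rw [← e2, ← intervalIntegral.integral_sub]
      · refine intervalIntegral.integral_congr fun x hx => ?_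
        rw [uIcc_of_le hab.le] at hx
        simp only [(hd n x).deriv, neg_neg, hHe x hx]
        rw [show -x - -b = b - x by ring]; ring
      · exact Continuous.intervalIntegrable (by fun_prop) _ _
      · exact Continuous.intervalIntegrable (by fun_prop) _ _
    simp_rw [e1]
    have t1 := Real.tendsto_integral_mul_deriv_smoothTransition hHc hkt hk1
    have t2 := Real.tendsto_integral_mul_deriv_smoothTransition (h := fun x => H (-x))
      (a := -b) (b := -a) (by fun_prop) hkt (fun n => by rw [neg_sub_neg]; exact hk1 n)
    have := t1.sub t2
    simp only [neg_neg] at this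
    rwa [hHe a (left_mem_Icc.2 hab.le), hHe b (right_mem_Icc.2 hab.le)] at this
  · refine intervalIntegral.tendsto_integral_filter_of_dominated_convergence (fun x => ‖v x‖)
      (.of_forall fun n => ?_) (.of_forall fun n => .of_forall fun x _ => ?_) hv.norm ?_
    · refine AEStronglyMeasurable.mul hv.def'.aestronglyMeasurable ?_
      exact Continuous.aestronglyMeasurable (by fun_prop)
    · rw [norm_mul]
      refine mul_le_of_le_one_right (norm_nonneg _) ?_
      rw [Real.norm_eq_abs, abs_le]
      have := Real.smoothTransition.nonneg (k n * (x - a))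
      have := Real.smoothTransition.nonneg (k n * (b - x))
      have := Real.smoothTransition.le_one (k n * (x - a))
      have := Real.smoothTransition.le_one (k n * (b - x))
      constructor <;> linarith
    · have hb : ∀ᵐ x : ℝ, x ≠ b := by simp [ae_iff, measure_singleton]
      filter_upwards [hb] with x hxb hx
      rw [uIoc_of_le hab.le] at hx
      have h1 : ∀ᶠ n in atTop, 1 ≤ k n * (x - a) :=
        (hkt.atTop_mul_const (sub_pos.2 hx.1)).eventually_ge_atTop 1
      have h2 : ∀ᶠ n in atTop, 1 ≤ k n * (b - x) :=
        (hkt.atTop_mul_const (sub_pos.2 (lt_of_le_of_ne hx.2 hxb))).eventually_ge_atTop 1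
      refine tendsto_const_nhds.congr' ?_
      filter_upwards [h1, h2] with n h1 h2
      rw [Real.smoothTransition.one_of_one_le h1, Real.smoothTransition.one_of_one_le h2]
      ring

/-! ### Absolute continuity on lines of continuous Sobolev functions. -/

theorem AbsolutelyContinuousOnInterval.lipschitzOnWith_comp {X Y : Type*} [PseudoMetricSpace X]
    [PseudoMetricSpace Y] {f : ℝ → X} {g : X → Y} {a b : ℝ} {K : NNReal} {s : Set X}
    (hg : LipschitzOnWith K g s) (hf : AbsolutelyContinuousOnInterval f a b)
    (hs : MapsTo f (uIcc a b) s) : AbsolutelyContinuousOnInterval (g ∘ f) a b := by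
  rw [absolutelyContinuousOnInterval_iff] at hf ⊢
  intro ε hε
  -- K + 1 instead of K, because K may be 0.
  obtain ⟨δ, hδ, h⟩ := hf (ε / (K + 1)) (by positivity)
  refine ⟨δ, hδ, fun E hE hE' => ?_⟩
  have h1 := h E hE hE'
  calc ∑ i ∈ Finset.range E.1, dist ((g ∘ f) (E.2 i).1) ((g ∘ f) (E.2 i).2)
      ≤ ∑ i ∈ Finset.range E.1, K * dist (f (E.2 i).1) (f (E.2 i).2) := by
        refine Finset.sum_le_sum fun i hi => ?_
        have := hE.1 i hi
        exact hg.dist_le_mul _ (hs this.1) _ (hs this.2)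
    _ = K * ∑ i ∈ Finset.range E.1, dist (f (E.2 i).1) (f (E.2 i).2) := by rw [Finset.mul_sum]
    _ ≤ (K + 1) * ∑ i ∈ Finset.range E.1, dist (f (E.2 i).1) (f (E.2 i).2) := by
        refine mul_le_mul_of_nonneg_right (by linarith) (Finset.sum_nonneg fun _ _ => dist_nonneg)
    _ < (K + 1) * (ε / (K + 1)) := by gcongr
    _ = ε := by field_simp

namespace Grushin

variable {Ω : Set (ℝ × ℝ)} {h v : ℝ × ℝ → ℝ} {a b c d : ℝ}

theorem volume_restrict_rect (a b c d : ℝ) :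
    (volume : Measure (ℝ × ℝ)).restrict (Icc a b ×ˢ Icc c d) =
      (volume.restrict (Icc a b)).prod (volume.restrict (Icc c d)) := by
  rw [Measure.volume_eq_prod, Measure.prod_restrict]

theorem isTestFunction_mul {ψ η : ℝ → ℝ} (hψ : ContDiff ℝ (⊤ : ℕ∞) ψ)
    (hψ0 : ∀ x ∉ Icc a b, ψ x = 0) (hη : ContDiff ℝ (⊤ : ℕ∞) η) (hηc : HasCompactSupport η)
    (hηs : tsupport η ⊆ Icc c d) (hR : Icc a b ×ˢ Icc c d ⊆ Ω) :
    IsTestFunction Ω fun p => ψ p.1 * η p.2 := by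
  have hsub : Function.support (fun p : ℝ × ℝ => ψ p.1 * η p.2) ⊆ Icc a b ×ˢ tsupport η := by
    intro p hp
    rw [Function.mem_support] at hp
    refine ⟨by_contra fun hn => hp (by rw [hψ0 _ hn, zero_mul]), subset_tsupport _ ?_⟩
    exact fun hn => hp (by simp only [hn, mul_zero])
  have hK : IsCompact (Icc a b ×ˢ tsupport η) := isCompact_Icc.prod hηc
  refine ⟨(hψ.comp contDiff_fst).mul (hη.comp contDiff_snd),
    HasCompactSupport.of_support_subset_isCompact hK hsub, ?_⟩
  exact (closure_minimal hsub hK.isClosed).trans ((prod_mono_right hηs).trans hR)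

/-- Testing against ψ(x)η(y) and applying Fubini gives ∫ η G = 0 for every smooth η supported in (c,
d), where G(y) is the slice integral of hψ' + vψ. Hence G = 0 almost everywhere, with an exceptional
set that depends on ψ. -/
theorem ae_integral_mul_deriv_eq_neg (hΩ : IsOpen Ω) (hR : Icc a b ×ˢ Icc c d ⊆ Ω)
    (hab : a ≤ b)
    (hh : ContinuousOn h (Icc a b ×ˢ Icc c d)) (hv : IntegrableOn v (Icc a b ×ˢ Icc c d))
    (hw : ∀ φ : ℝ × ℝ → ℝ, IsTestFunction Ω φ →
      ∫ p in Ω, h p * partialX φ p = -∫ p in Ω, v p * φ p)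
    {ψ : ℝ → ℝ} (hψ : ContDiff ℝ (⊤ : ℕ∞) ψ) (hψ0 : ∀ x ∉ Icc a b, ψ x = 0) :
    ∀ᵐ y : ℝ, y ∈ Ioo c d →
      ∫ x in a..b, h (x, y) * deriv ψ x = -∫ x in a..b, v (x, y) * ψ x := by
  have hψc : Continuous ψ := hψ.continuous
  have hψd : Continuous (deriv ψ) := hψ.continuous_deriv (by simp)
  have hRc : IsCompact (Icc a b ×ˢ Icc c d) := isCompact_Icc.prod isCompact_Icc
  have hi1 : IntegrableOn (fun p => h p * deriv ψ p.1) (Icc a b ×ˢ Icc c d) :=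
    (hh.mul (by fun_prop)).integrableOn_compact hRc
  have hi2 : IntegrableOn (fun p => v p * ψ p.1) (Icc a b ×ˢ Icc c d) :=
    hv.mul_continuousOn (g' := fun p => ψ p.1) (by fun_prop) hRc
  have hi : Integrable (fun p => h p * deriv ψ p.1 + v p * ψ p.1)
      ((volume.restrict (Icc a b)).prod (volume.restrict (Icc c d))) := by
    rw [← volume_restrict_rect]; exact hi1.add hi2
  set G : ℝ → ℝ := fun y => ∫ x in Icc a b, (h (x, y) * deriv ψ x + v (x, y) * ψ x) with hG
  have hGi : IntegrableOn G (Icc c d) := hi.integral_prod_right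
  have hG0 : ∀ᵐ y : ℝ, y ∈ Ioo c d → G y = 0 := by
    refine isOpen_Ioo.ae_eq_zero_of_integral_contDiff_smul_eq_zero
      ((hGi.mono_set Ioo_subset_Icc_self).locallyIntegrableOn) fun η hη hηc hηs => ?_
    have hηs' : tsupport η ⊆ Icc c d := hηs.trans Ioo_subset_Icc_self
    have htest := isTestFunction_mul hψ hψ0 hη hηc hηs' hR
    have hη0 : ∀ y ∉ Icc c d, η y = 0 := fun y hy =>
      image_eq_zero_of_notMem_tsupport fun hn => hy (hηs' hn)
    have hpx : ∀ p : ℝ × ℝ, partialX (fun p => ψ p.1 * η p.2) p = deriv ψ p.1 * η p.2 := by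
      intro p
      simp only [partialX]
      exact deriv_mul_const ((hψ.differentiable (by simp)) _) _
    have hψd0 : ∀ x ∉ Icc a b, deriv ψ x = 0 := by
      intro x hx
      have : ψ =ᶠ[𝓝 x] fun _ => 0 := by
        filter_upwards [isClosed_Icc.isOpen_compl.mem_nhds hx] with z hz using hψ0 z hz
      rw [this.deriv_eq, deriv_const]
    have key := hw _ htest
    simp only [hpx] at key
    rw [setIntegral_eq_of_subset_of_forall_sdiff_eq_zero hΩ.measurableSet hR (f := fun p : ℝ × ℝ =>
        h p * (deriv ψ p.1 * η p.2)),
      setIntegral_eq_of_subset_of_forall_sdiff_eq_zero hΩ.measurableSet hR (f := fun p : ℝ × ℝ =>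
        v p * (ψ p.1 * η p.2)), eq_neg_iff_add_eq_zero, ← integral_add] at key
    · have e1 : ∫ y, η y • G y = ∫ y in Icc c d, η y • G y := by
        rw [setIntegral_eq_integral_of_forall_compl_eq_zero]
        intro y hy; rw [hη0 y hy, zero_smul]
      have hi' : Integrable (fun p : ℝ × ℝ => η p.2 * (h p * deriv ψ p.1 + v p * ψ p.1))
          ((volume.restrict (Icc a b)).prod (volume.restrict (Icc c d))) := by
        rw [← volume_restrict_rect] at hi ⊢
        exact IntegrableOn.continuousOn_mul (g := fun p : ℝ × ℝ => η p.2)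
          (hη.continuous.comp continuous_snd).continuousOn hi hRc
      rw [e1]
      rw [volume_restrict_rect] at key
      rw [← key]
      have e2 := integral_prod_symm _ hi'
      have e3 : ∀ p : ℝ × ℝ, h p * (deriv ψ p.1 * η p.2) + v p * (ψ p.1 * η p.2) =
          η p.2 * (h p * deriv ψ p.1 + v p * ψ p.1) := fun p => by ring
      simp_rw [e3]
      rw [e2]
      refine integral_congr_ae (.of_forall fun y => ?_)
      simp only [hG, smul_eq_mul]
      rw [integral_const_mul]
    · have := hi1.mul_continuousOn (g' := fun p : ℝ × ℝ => η p.2)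
        (hη.continuous.comp continuous_snd).continuousOn hRc
      exact this.congr (.of_forall fun p => by simp only; ring)
    · have := hi2.mul_continuousOn (g' := fun p : ℝ × ℝ => η p.2)
        (hη.continuous.comp continuous_snd).continuousOn hRc
      exact this.congr (.of_forall fun p => by simp only; ring)
    · rintro p ⟨-, hp⟩
      rw [mem_prod, not_and_or] at hp
      rcases hp with hp | hp
      · rw [hψ0 _ hp]; ring
      · rw [hη0 _ hp]; ring
    · rintro p ⟨-, hp⟩
      rw [mem_prod, not_and_or] at hp
      rcases hp with hp | hp
      · rw [hψd0 _ hp]; ring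
      · rw [hη0 _ hp]; ring
  have hs1 : ∀ᵐ y : ℝ, y ∈ Icc c d → IntegrableOn (fun x => h (x, y) * deriv ψ x) (Icc a b) := by
    rw [← ae_restrict_iff' measurableSet_Icc]
    rw [IntegrableOn, volume_restrict_rect] at hi1
    exact hi1.prod_left_ae
  have hs2 : ∀ᵐ y : ℝ, y ∈ Icc c d → IntegrableOn (fun x => v (x, y) * ψ x) (Icc a b) := by
    rw [← ae_restrict_iff' measurableSet_Icc]
    rw [IntegrableOn, volume_restrict_rect] at hi2
    exact hi2.prod_left_ae
  filter_upwards [hG0, hs1, hs2] with y h0 h1 h2 hy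
  have hy' := Ioo_subset_Icc_self hy
  have := h0 hy
  rw [hG] at this
  simp only at this
  rw [integral_add (h1 hy') (h2 hy')] at this
  rw [intervalIntegral.integral_of_le hab, intervalIntegral.integral_of_le hab,
    ← integral_Icc_eq_integral_Ioc, ← integral_Icc_eq_integral_Ioc]
  linarith

theorem ae_integrableOn_slice (hv : IntegrableOn v (Icc a b ×ˢ Icc c d)) :
    ∀ᵐ y : ℝ, y ∈ Icc c d → IntegrableOn (fun x => v (x, y)) (Icc a b) := by
  rw [← ae_restrict_iff' measurableSet_Icc]
  rw [IntegrableOn, volume_restrict_rect] at hv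
  exact hv.prod_left_ae

theorem continuousOn_slice (hh : ContinuousOn h (Icc a b ×ˢ Icc c d)) {y : ℝ} (hy : y ∈ Icc c d) :
    ContinuousOn (fun x => h (x, y)) (Icc a b) :=
  hh.comp (by fun_prop) fun _ hx => ⟨hx, hy⟩

/-- Only countably many cutoffs ψ n are used, so one null set of lines serves them all and the limit
can be taken on each remaining line. -/
theorem ae_sub_eq_integral_endpoints (hΩ : IsOpen Ω) (hR : Icc a b ×ˢ Icc c d ⊆ Ω)
    (hab : a < b)
    (hh : ContinuousOn h (Icc a b ×ˢ Icc c d)) (hv : IntegrableOn v (Icc a b ×ˢ Icc c d))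
    (hw : ∀ φ : ℝ × ℝ → ℝ, IsTestFunction Ω φ →
      ∫ p in Ω, h p * partialX φ p = -∫ p in Ω, v p * φ p) :
    ∀ᵐ y : ℝ, y ∈ Ioo c d → h (b, y) - h (a, y) = ∫ x in a..b, v (x, y) := by
  obtain ⟨ψ, hψ, hψ0, hψh, hψv⟩ := exists_smooth_tendsto_indicator hab
  have h1 := ae_all_iff.2 fun n =>
    ae_integral_mul_deriv_eq_neg hΩ hR hab.le hh hv hw (hψ n) (hψ0 n)
  filter_upwards [h1, ae_integrableOn_slice hv] with y h1 h2 hy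
  have hy' := Ioo_subset_Icc_self hy
  have t1 := hψh _ (continuousOn_slice hh hy')
  have t2 := (hψv (fun x => v (x, y))
    ((intervalIntegrable_iff_integrableOn_Icc_of_le hab.le).2 (h2 hy'))).neg
  have := tendsto_nhds_unique (t1.congr fun n => h1 n hy) t2
  linarith

/-- A continuous function with an integrable weak derivative in the `x` direction is, on almost
every horizontal line, the integral of this weak derivative. -/
theorem ae_sub_eq_integral (hΩ : IsOpen Ω) (hR : Icc a b ×ˢ Icc c d ⊆ Ω) (hab : a < b)
    (hh : ContinuousOn h (Icc a b ×ˢ Icc c d)) (hv : IntegrableOn v (Icc a b ×ˢ Icc c d))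
    (hw : ∀ φ : ℝ × ℝ → ℝ, IsTestFunction Ω φ →
      ∫ p in Ω, h p * partialX φ p = -∫ p in Ω, v p * φ p) :
    ∀ᵐ y : ℝ, y ∈ Ioo c d → IntegrableOn (fun x => v (x, y)) (Icc a b) ∧
      ∀ x ∈ Icc a b, h (x, y) = h (a, y) + ∫ s in a..x, v (s, y) := by
  -- Rational right endpoints keep the union of exceptional sets null; continuity in x then reaches
  -- every endpoint.
  have hrat : ∀ᵐ y : ℝ, ∀ r : ℚ, (r : ℝ) ∈ Ioo a b → y ∈ Ioo c d →
      h (r, y) - h (a, y) = ∫ x in a..r, v (x, y) := by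
    refine ae_all_iff.2 fun r => ?_
    by_cases hr : (r : ℝ) ∈ Ioo a b
    · have hsub : Icc a (r : ℝ) ×ˢ Icc c d ⊆ Icc a b ×ˢ Icc c d :=
        prod_mono_left (Icc_subset_Icc_right hr.2.le)
      filter_upwards [ae_sub_eq_integral_endpoints hΩ (hsub.trans hR) hr.1 (hh.mono hsub)
        (hv.mono_set hsub) hw] with y hy _ using hy
    · exact .of_forall fun y hr' => absurd hr' hr
  filter_upwards [hrat, ae_integrableOn_slice hv] with y h1 h2 hy
  have hy' := Ioo_subset_Icc_self hy
  refine ⟨h2 hy', ?_⟩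
  have hc2 : ContinuousOn (fun x => h (a, y) + ∫ s in a..x, v (s, y)) (Icc a b) := by
    refine continuousOn_const.add ?_
    have := intervalIntegral.continuousOn_primitive_interval (μ := volume) (f := fun x => v (x, y))
      (a := a) (b := b) (by rw [uIcc_of_le hab.le]; exact h2 hy')
    rwa [uIcc_of_le hab.le] at this
  have heq : EqOn (fun x => h (x, y)) (fun x => h (a, y) + ∫ s in a..x, v (s, y))
      (Ioo a b ∩ range ((↑) : ℚ → ℝ)) := by
    rintro _ ⟨hx, r, rfl⟩
    have := h1 r hx hy
    simp only
    linarith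
  refine heq.of_subset_closure (continuousOn_slice hh hy') hc2
    (inter_subset_left.trans Ioo_subset_Icc_self) ?_
  have hd : DenseRange ((↑) : ℚ → ℝ) := Rat.denseRange_cast
  rw [← closure_Ioo hab.ne]
  exact closure_minimal (hd.open_subset_closure_inter isOpen_Ioo) isClosed_closure

theorem ae_absolutelyContinuous_hasDerivAt (hΩ : IsOpen Ω) (hR : Icc a b ×ˢ Icc c d ⊆ Ω)
    (hab : a < b)
    (hh : ContinuousOn h (Icc a b ×ˢ Icc c d)) (hv : IntegrableOn v (Icc a b ×ˢ Icc c d))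
    (hw : ∀ φ : ℝ × ℝ → ℝ, IsTestFunction Ω φ →
      ∫ p in Ω, h p * partialX φ p = -∫ p in Ω, v p * φ p) :
    ∀ᵐ y : ℝ, y ∈ Ioo c d → AbsolutelyContinuousOnInterval (fun x => h (x, y)) a b ∧
      ∀ᵐ x : ℝ, x ∈ Ioo a b → HasDerivAt (fun s => h (s, y)) (v (x, y)) x := by
  filter_upwards [ae_sub_eq_integral hΩ hR hab hh hv hw] with y hy hyI
  obtain ⟨h1, h2⟩ := hy hyI
  have hint := (intervalIntegrable_iff_integrableOn_Icc_of_le hab.le).2 h1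
  constructor
  · have hac := hint.absolutelyContinuousOnInterval_intervalIntegral (c := a) left_mem_uIcc
    have hac' : AbsolutelyContinuousOnInterval (fun x => h (a, y) + ∫ s in a..x, v (s, y)) a b :=
      ((LipschitzWith.const (h (a, y))).lipschitzOnWith.absolutelyContinuousOnInterval).fun_add hac
    rw [absolutelyContinuousOnInterval_iff] at hac' ⊢
    intro ε hε
    obtain ⟨δ, hδ, h3⟩ := hac' ε hε
    refine ⟨δ, hδ, fun E hE hE' => ?_⟩
    refine lt_of_eq_of_lt (Finset.sum_congr rfl fun i hi => ?_) (h3 E hE hE')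
    have h4 := hE.1 i hi
    rw [uIcc_of_le hab.le] at h4
    rw [h2 _ h4.1, h2 _ h4.2]
  · filter_upwards [hint.ae_hasDerivAt_integral] with x hx hxI
    have hx' : x ∈ uIcc a b := by rw [uIcc_of_le hab.le]; exact Ioo_subset_Icc_self hxI
    have := (hx hx' a left_mem_uIcc).const_add (h (a, y))
    refine this.congr_of_eventuallyEq ?_
    filter_upwards [Ioo_mem_nhds hxI.1 hxI.2] with s hs using h2 s (Ioo_subset_Icc_self hs)

end Grushin

/-! ### Partial derivatives and Fubini on rectangles. -/

/-- A zero with nonzero derivative is isolated among the zeros, and a discrete subset of the line is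
countable. Applied slicewise, it makes a partial derivative vanish almost everywhere on the zero set
of the function. -/
theorem Set.countable_setOf_eq_zero_deriv_ne_zero (k : ℝ → ℝ) :
    {x | k x = 0 ∧ deriv k x ≠ 0}.Countable := by
  have hd : DiscreteTopology {x | k x = 0 ∧ deriv k x ≠ 0} := by
    rw [discreteTopology_subtype_iff]
    rintro x ⟨-, hx⟩
    have h1 := (differentiableAt_of_deriv_ne_zero hx).hasDerivAt.eventually_ne (c := 0) hx
    rw [← disjoint_iff, disjoint_principal_right]
    filter_upwards [h1] with z hz hz' using hz hz'.1
  have : Countable {x | k x = 0 ∧ deriv k x ≠ 0} := countable_of_Lindelof_of_discrete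
  exact this

namespace Grushin

variable {Ω : Set (ℝ × ℝ)} {h v : ℝ × ℝ → ℝ} {a b c d : ℝ}

/-- Clamping the coordinates yields a globally continuous function, for which the partial derivative
is measurable. This measurability is what Fubini needs to pass from lines to the rectangle. -/
theorem exists_continuous_extension_rect (hab : a ≤ b) (hcd : c ≤ d)
    (hh : ContinuousOn h (Icc a b ×ˢ Icc c d)) :
    ∃ H : ℝ × ℝ → ℝ, Continuous H ∧ ∀ p ∈ Ioo a b ×ˢ Ioo c d, H p = h p ∧
      partialX H p = partialX h p := by
  have hH : ∀ p ∈ Icc a b ×ˢ Icc c d,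
      h ((projIcc a b hab p.1 : ℝ), (projIcc c d hcd p.2 : ℝ)) = h p := by
    rintro ⟨x, y⟩ ⟨hx, hy⟩
    simp only
    rw [projIcc_of_mem hab hx, projIcc_of_mem hcd hy]
  refine ⟨fun p => h ((projIcc a b hab p.1 : ℝ), (projIcc c d hcd p.2 : ℝ)), ?_, ?_⟩
  · exact hh.comp_continuous (by fun_prop) fun p => ⟨Subtype.prop _, Subtype.prop _⟩
  · rintro ⟨x, y⟩ ⟨hx, hy⟩
    refine ⟨hH _ ⟨Ioo_subset_Icc_self hx, Ioo_subset_Icc_self hy⟩, ?_⟩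
    refine Filter.EventuallyEq.deriv_eq ?_
    filter_upwards [Ioo_mem_nhds hx.1 hx.2] with s hs
    exact hH (s, y) ⟨Ioo_subset_Icc_self hs, Ioo_subset_Icc_self hy⟩

theorem measurable_partialX {H : ℝ × ℝ → ℝ} (hH : Continuous H) : Measurable (partialX H) := by
  have h1 : Continuous (Function.uncurry fun y x : ℝ => H (x, y)) := by
    simp only [Function.uncurry_def]; fun_prop
  exact (measurable_deriv_with_param h1).comp measurable_swap

theorem ae_mem_Ioo_prod (a b c d : ℝ) :
    ∀ᵐ p ∂(volume : Measure (ℝ × ℝ)).restrict (Icc a b ×ˢ Icc c d), p ∈ Ioo a b ×ˢ Ioo c d := by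
  rw [volume_restrict_rect, ← restrict_Ioo_eq_restrict_Icc, ← restrict_Ioo_eq_restrict_Icc,
    Measure.prod_restrict]
  exact ae_restrict_mem (measurableSet_Ioo.prod measurableSet_Ioo)

theorem ae_rect_of_ae_ae {P : ℝ × ℝ → Prop} (hP : MeasurableSet {p | P p})
    (hae : ∀ᵐ y : ℝ, y ∈ Ioo c d → ∀ᵐ x : ℝ, x ∈ Ioo a b → P (x, y)) :
    ∀ᵐ p ∂(volume : Measure (ℝ × ℝ)).restrict (Icc a b ×ˢ Icc c d), P p := by
  rw [volume_restrict_rect, Measure.ae_prod_iff_ae_ae hP,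
    Measure.ae_ae_comm (p := fun x y => P (x, y)) hP, ← restrict_Ioo_eq_restrict_Icc,
    ← restrict_Ioo_eq_restrict_Icc, ae_restrict_iff' measurableSet_Ioo]
  filter_upwards [hae] with y hy hyI
  rw [ae_restrict_iff' measurableSet_Ioo]
  exact hy hyI

theorem ae_partialX_eq_zero (hab : a < b) (hcd : c < d)
    (hh : ContinuousOn h (Icc a b ×ˢ Icc c d)) :
    ∀ᵐ p ∂(volume : Measure (ℝ × ℝ)).restrict (Icc a b ×ˢ Icc c d),
      h p = 0 → partialX h p = 0 := by
  obtain ⟨H, hHc, hH⟩ := exists_continuous_extension_rect hab.le hcd.le hh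
  have h1 : ∀ᵐ p ∂(volume : Measure (ℝ × ℝ)).restrict (Icc a b ×ˢ Icc c d),
      H p = 0 → partialX H p = 0 := by
    refine ae_rect_of_ae_ae ?_ (.of_forall fun y _ => ?_)
    · have : {p | H p = 0 → partialX H p = 0} = {p | H p = 0}ᶜ ∪ {p | partialX H p = 0} := by
        ext p; simp [imp_iff_not_or]
      rw [this]
      exact (hHc.measurable (measurableSet_singleton 0)).compl.union
        (measurable_partialX hHc (measurableSet_singleton 0))
    · have := (Set.countable_setOf_eq_zero_deriv_ne_zero fun s => H (s, y)).ae_notMem volume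
      filter_upwards [this] with x hx _ h0
      by_contra hne
      exact hx ⟨h0, hne⟩
  filter_upwards [h1, ae_mem_Ioo_prod a b c d] with p hp hpI
  rw [← (hH p hpI).1, ← (hH p hpI).2]
  exact hp

theorem ae_partialX_eq (hΩ : IsOpen Ω) (hR : Icc a b ×ˢ Icc c d ⊆ Ω) (hab : a < b) (hcd : c < d)
    (hh : ContinuousOn h (Icc a b ×ˢ Icc c d)) (hv : IntegrableOn v (Icc a b ×ˢ Icc c d))
    (hw : ∀ φ : ℝ × ℝ → ℝ, IsTestFunction Ω φ →
      ∫ p in Ω, h p * partialX φ p = -∫ p in Ω, v p * φ p) :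
    ∀ᵐ p ∂(volume : Measure (ℝ × ℝ)).restrict (Icc a b ×ˢ Icc c d), partialX h p = v p := by
  obtain ⟨H, hHc, hH⟩ := exists_continuous_extension_rect hab.le hcd.le hh
  -- A measurable representative makes the set where the two derivatives agree measurable.
  obtain ⟨v', hv'm, hvv'⟩ := hv.aestronglyMeasurable
  have hslice : ∀ᵐ y : ℝ, y ∈ Icc c d → ∀ᵐ x : ℝ, x ∈ Icc a b → v (x, y) = v' (x, y) := by
    have h2 := hvv'
    rw [volume_restrict_rect] at h2
    have h3 : ∀ᵐ q ∂(volume.restrict (Icc c d)).prod (volume.restrict (Icc a b)),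
        v q.swap = v' q.swap :=
      Measure.measurePreserving_swap.quasiMeasurePreserving.ae h2
    have h4 := Measure.ae_ae_of_ae_prod h3
    rw [ae_restrict_iff' measurableSet_Icc] at h4
    filter_upwards [h4] with y hy hyI
    rw [← ae_restrict_iff' measurableSet_Icc]
    exact hy hyI
  have h1 : ∀ᵐ p ∂(volume : Measure (ℝ × ℝ)).restrict (Icc a b ×ˢ Icc c d),
      p ∈ Ioo a b ×ˢ Ioo c d → partialX H p = v' p := by
    refine ae_rect_of_ae_ae ?_ ?_
    · have : {p | p ∈ Ioo a b ×ˢ Ioo c d → partialX H p = v' p} =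
          (Ioo a b ×ˢ Ioo c d)ᶜ ∪ {p | partialX H p = v' p} := by
        ext p; simp only [imp_iff_not_or]; rfl
      rw [this]
      exact (measurableSet_Ioo.prod measurableSet_Ioo).compl.union
        (measurableSet_eq_fun (measurable_partialX hHc) hv'm.measurable)
    · filter_upwards [hslice, ae_absolutelyContinuous_hasDerivAt hΩ hR hab hh hv hw]
        with y hy1 hy2 hyI
      filter_upwards [hy1 (Ioo_subset_Icc_self hyI), (hy2 hyI).2] with x hx1 hx2 hxI hxy
      rw [(hH _ hxy).2, ← hx1 (Ioo_subset_Icc_self hxI)]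
      exact (hx2 hxI).deriv
  filter_upwards [h1, ae_mem_Ioo_prod a b c d, hvv'] with p hp hpI hpv
  rw [← (hH p hpI).2, hp hpI, hpv]

/-- Fubini and the fundamental theorem of calculus for the composition of a continuous function with
an integrable weak derivative `∂/∂x` and a `C¹` function. -/
theorem integral_sub_eq_integral_partialX (hΩ : IsOpen Ω) (hR : Icc a b ×ˢ Icc c d ⊆ Ω)
    (hab : a < b) (hcd : c < d)
    (hh : ContinuousOn h (Icc a b ×ˢ Icc c d)) (hv : IntegrableOn v (Icc a b ×ˢ Icc c d))
    (hw : ∀ φ : ℝ × ℝ → ℝ, IsTestFunction Ω φ →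
      ∫ p in Ω, h p * partialX φ p = -∫ p in Ω, v p * φ p)
    {Ψ ψ m : ℝ → ℝ} (hΨ : ∀ x, HasDerivAt Ψ (ψ x) x) (hψ : Continuous ψ) (hm : Continuous m) :
    IntegrableOn (fun p => m p.2 * (ψ (h p) * partialX h p)) (Icc a b ×ˢ Icc c d) ∧
    ∫ y in c..d, m y * (Ψ (h (b, y)) - Ψ (h (a, y))) =
      ∫ p in Icc a b ×ˢ Icc c d, m p.2 * (ψ (h p) * partialX h p) := by
  have hRc : IsCompact (Icc a b ×ˢ Icc c d) := isCompact_Icc.prod isCompact_Icc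
  have hderiv : deriv Ψ = ψ := funext fun x => (hΨ x).deriv
  have hlip : LocallyLipschitz Ψ := by
    refine ContDiff.locallyLipschitz (𝕂 := ℝ)
      (contDiff_one_iff_deriv.2 ⟨fun x => (hΨ x).differentiableAt, ?_⟩)
    rwa [hderiv]
  have hint : IntegrableOn (fun p => m p.2 * (ψ (h p) * partialX h p)) (Icc a b ×ˢ Icc c d) := by
    have h1 : IntegrableOn (fun p => (m p.2 * ψ (h p)) * v p) (Icc a b ×ˢ Icc c d) := by
      refine IntegrableOn.continuousOn_mul ?_ hv hRc
      exact (hm.comp continuous_snd).continuousOn.mul (hψ.comp_continuousOn hh)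
    refine h1.congr ?_
    filter_upwards [ae_partialX_eq hΩ hR hab hcd hh hv hw] with p hp
    rw [hp, mul_assoc]
  refine ⟨hint, ?_⟩
  have hint' := hint
  rw [IntegrableOn, volume_restrict_rect] at hint'
  rw [volume_restrict_rect, integral_prod_symm _ hint', intervalIntegral.integral_of_le hcd.le,
    ← integral_Icc_eq_integral_Ioc, ← restrict_Ioo_eq_restrict_Icc (a := c)]
  refine integral_congr_ae ?_
  rw [EventuallyEq, ae_restrict_iff' measurableSet_Ioo]
  filter_upwards [ae_absolutelyContinuous_hasDerivAt hΩ hR hab hh hv hw] with y hy hyI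
  obtain ⟨hac, hder⟩ := hy hyI
  have himg : IsCompact ((fun x => h (x, y)) '' uIcc a b) :=
    isCompact_uIcc.image_of_continuousOn hac.continuousOn
  -- Ψ is Lipschitz on the compact range of the slice, so the composition stays absolutely
  -- continuous and obeys the fundamental theorem of calculus.
  obtain ⟨K, hK⟩ := (hlip.locallyLipschitzOn (s := (fun x => h (x, y)) '' uIcc a b)
    ).exists_lipschitzOnWith_of_compact himg
  have hac' := AbsolutelyContinuousOnInterval.lipschitzOnWith_comp hK hac (mapsTo_image _ _)
  have hsub := hac'.integral_deriv_eq_sub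
  simp only [Function.comp] at hsub
  rw [← hsub, integral_const_mul, intervalIntegral.integral_of_le hab.le,
    ← integral_Icc_eq_integral_Ioc, ← restrict_Ioo_eq_restrict_Icc]
  congr 1
  refine integral_congr_ae ?_
  rw [EventuallyEq, ae_restrict_iff' measurableSet_Ioo]
  filter_upwards [hder] with x hx hxI
  have h1 := hx hxI
  have h2 : deriv (Ψ ∘ fun x => h (x, y)) x = ψ (h (x, y)) * v (x, y) :=
    ((hΨ (h (x, y))).comp x h1).deriv
  rw [h2, show partialX h (x, y) = v (x, y) from h1.deriv]

theorem isTestFunction_comp_swap {φ : ℝ × ℝ → ℝ} (hφ : IsTestFunction (Prod.swap ⁻¹' Ω) φ) :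
    IsTestFunction Ω (φ ∘ Prod.swap) := by
  obtain ⟨h1, h2, h3⟩ := hφ
  refine ⟨h1.comp (contDiff_snd.prodMk contDiff_fst),
    h2.comp_homeomorph (Homeomorph.prodComm ℝ ℝ), ?_⟩
  have : tsupport (φ ∘ Prod.swap) = Prod.swap ⁻¹' tsupport φ :=
    tsupport_comp_eq_preimage φ (Homeomorph.prodComm ℝ ℝ)
  rw [this]
  intro p hp
  simpa using h3 hp

theorem measurePreserving_swap_volume :
    MeasurePreserving Prod.swap (volume : Measure (ℝ × ℝ)) (volume : Measure (ℝ × ℝ)) :=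
  Measure.measurePreserving_swap

theorem setIntegral_preimage_swap (S : Set (ℝ × ℝ)) (f : ℝ × ℝ → ℝ) :
    ∫ p in Prod.swap ⁻¹' S, f p.swap = ∫ p in S, f p :=
  measurePreserving_swap_volume.setIntegral_preimage_emb
    MeasurableEquiv.prodComm.measurableEmbedding f S

theorem weakPartialX_comp_swap
    (hw : ∀ φ : ℝ × ℝ → ℝ, IsTestFunction Ω φ →
      ∫ p in Ω, h p * partialY φ p = -∫ p in Ω, v p * φ p) :
    ∀ φ : ℝ × ℝ → ℝ, IsTestFunction (Prod.swap ⁻¹' Ω) φ →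
      ∫ p in Prod.swap ⁻¹' Ω, (h ∘ Prod.swap) p * partialX φ p =
        -∫ p in Prod.swap ⁻¹' Ω, (v ∘ Prod.swap) p * φ p := by
  intro φ hφ
  have key := hw _ (isTestFunction_comp_swap hφ)
  rw [← setIntegral_preimage_swap, ← setIntegral_preimage_swap Ω] at key
  exact key

theorem integrableOn_comp_swap (hv : IntegrableOn v (Icc a b ×ˢ Icc c d)) :
    IntegrableOn (v ∘ Prod.swap) (Icc c d ×ˢ Icc a b) := by
  have := (measurePreserving_swap_volume.integrableOn_comp_preimage
    MeasurableEquiv.prodComm.measurableEmbedding (f := v) (s := Icc a b ×ˢ Icc c d)).2 hv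
  rwa [preimage_swap_prod] at this

theorem continuousOn_comp_swap (hh : ContinuousOn h (Icc a b ×ˢ Icc c d)) :
    ContinuousOn (h ∘ Prod.swap) (Icc c d ×ˢ Icc a b) :=
  hh.comp continuous_swap.continuousOn fun _ hp => ⟨hp.2, hp.1⟩

theorem ae_rect_of_swap {P : ℝ × ℝ → Prop}
    (hP : ∀ᵐ p ∂(volume : Measure (ℝ × ℝ)).restrict (Icc c d ×ˢ Icc a b), P p.swap) :
    ∀ᵐ p ∂(volume : Measure (ℝ × ℝ)).restrict (Icc a b ×ˢ Icc c d), P p := by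
  rw [volume_restrict_rect] at hP ⊢
  exact Measure.measurePreserving_swap.quasiMeasurePreserving.ae hP

theorem ae_partialY_eq_zero (hab : a < b) (hcd : c < d)
    (hh : ContinuousOn h (Icc a b ×ˢ Icc c d)) :
    ∀ᵐ p ∂(volume : Measure (ℝ × ℝ)).restrict (Icc a b ×ˢ Icc c d),
      h p = 0 → partialY h p = 0 :=
  ae_rect_of_swap (ae_partialX_eq_zero hcd hab (continuousOn_comp_swap hh))

theorem integral_sub_eq_integral_partialY (hΩ : IsOpen Ω) (hR : Icc a b ×ˢ Icc c d ⊆ Ω)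
    (hab : a < b) (hcd : c < d)
    (hh : ContinuousOn h (Icc a b ×ˢ Icc c d)) (hv : IntegrableOn v (Icc a b ×ˢ Icc c d))
    (hw : ∀ φ : ℝ × ℝ → ℝ, IsTestFunction Ω φ →
      ∫ p in Ω, h p * partialY φ p = -∫ p in Ω, v p * φ p)
    {Ψ ψ m : ℝ → ℝ} (hΨ : ∀ x, HasDerivAt Ψ (ψ x) x) (hψ : Continuous ψ) (hm : Continuous m) :
    IntegrableOn (fun p => m p.1 * (ψ (h p) * partialY h p)) (Icc a b ×ˢ Icc c d) ∧
    ∫ x in a..b, m x * (Ψ (h (x, d)) - Ψ (h (x, c))) =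
      ∫ p in Icc a b ×ˢ Icc c d, m p.1 * (ψ (h p) * partialY h p) := by
  have hR' : Icc c d ×ˢ Icc a b ⊆ Prod.swap ⁻¹' Ω := fun p hp => hR ⟨hp.2, hp.1⟩
  obtain ⟨h1, h2⟩ := integral_sub_eq_integral_partialX (hΩ.preimage continuous_swap) hR' hcd hab
    (continuousOn_comp_swap hh) (integrableOn_comp_swap hv) (weakPartialX_comp_swap hw) hΨ hψ hm
  refine ⟨integrableOn_comp_swap h1, ?_⟩
  rw [← setIntegral_preimage_swap, preimage_swap_prod]
  exact h2

end Grushin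

/-! ### Cauchy–Riemann equations and Morera's theorem. -/

theorem Matrix.eq_of_mem_orthogonalGroup_of_det_pos {Q : Matrix (Fin 2) (Fin 2) ℝ}
    (hQ : Q ∈ Matrix.orthogonalGroup (Fin 2) ℝ) (hdet : 0 < Q.det) :
    Q 0 0 = Q 1 1 ∧ Q 0 1 = -Q 1 0 := by
  have h := (Matrix.mem_orthogonalGroup_iff' _ _).1 hQ
  have h00 := congrFun (congrFun h 0) 0
  have h01 := congrFun (congrFun h 0) 1
  have h11 := congrFun (congrFun h 1) 1
  simp only [Matrix.mul_apply, Fin.sum_univ_two, Matrix.transpose_apply,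
    Matrix.one_apply_eq, Matrix.one_apply_ne (show (0 : Fin 2) ≠ 1 by decide)] at h00 h01 h11
  rw [Matrix.det_fin_two] at hdet
  have hdet1 : Q 0 0 * Q 1 1 - Q 0 1 * Q 1 0 = 1 := by
    have hsq : (Q 0 0 * Q 1 1 - Q 0 1 * Q 1 0) ^ 2 = 1 := by
      linear_combination (Q 0 1 * Q 0 1 + Q 1 1 * Q 1 1) * h00 + h11 -
        (Q 0 0 * Q 0 1 + Q 1 0 * Q 1 1) * h01
    nlinarith
  -- The left side is the sum of the squared entries, which is 2, minus twice the determinant.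
  have hs : (Q 0 0 - Q 1 1) ^ 2 + (Q 0 1 + Q 1 0) ^ 2 = 0 := by
    linear_combination h00 + h11 - 2 * hdet1
  constructor
  · nlinarith [sq_nonneg (Q 0 0 - Q 1 1), sq_nonneg (Q 0 1 + Q 1 0)]
  · nlinarith [sq_nonneg (Q 0 0 - Q 1 1), sq_nonneg (Q 0 1 + Q 1 0)]

namespace Grushin

variable {α : ℝ} {Ω Ω' : Set (ℝ × ℝ)} {g : ℝ × ℝ → ℝ × ℝ} {a b c d : ℝ}

/-- det D_H g vanishes where x = 0, because Y_α does, and almost everywhere on {g₁ = 0}, because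
both partial derivatives of g₁ do. Positivity of the determinant therefore makes S_g a null set. -/
theorem ae_ne_zero_of_orientationPreserving (hα : 0 < α) (hR : Icc a b ×ˢ Icc c d ⊆ Ω)
    (hab : a < b) (hcd : c < d) (hg : ContinuousOn g Ω)
    (horient : ∀ᵐ p : ℝ × ℝ, p ∈ Ω → 0 < (matrixDH α g p).det) :
    ∀ᵐ p ∂(volume : Measure (ℝ × ℝ)).restrict (Icc a b ×ˢ Icc c d),
      p.1 ≠ 0 ∧ (g p).1 ≠ 0 ∧ 0 < (matrixDH α g p).det := by
  have hRm : MeasurableSet (Icc a b ×ˢ Icc c d) := measurableSet_Icc.prod measurableSet_Icc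
  have hg1 : ContinuousOn (fun p => (g p).1) (Icc a b ×ˢ Icc c d) :=
    continuous_fst.comp_continuousOn (hg.mono hR)
  filter_upwards [ae_restrict_of_ae horient, ae_restrict_mem hRm, ae_partialX_eq_zero hab hcd hg1,
    ae_partialY_eq_zero hab hcd hg1] with p hp hpR hX hY
  have hdet := hp (hR hpR)
  refine ⟨fun h0 => ?_, fun h0 => ?_, hdet⟩
  · simp [matrixDH, Matrix.det_fin_two, fieldY, h0, Real.zero_rpow hα.ne'] at hdet
  · simp [matrixDH, Matrix.det_fin_two, fieldY, hX h0, hY h0] at hdet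

/-- A positive determinant makes the orthogonal factor a rotation. The equations are those of F in s
+ iy multiplied by |x|^α, so nothing is divided by |x|^α. -/
theorem ae_cauchyRiemann (hα : 0 < α) (hR : Icc a b ×ˢ Icc c d ⊆ Ω)
    (hab : a < b) (hcd : c < d) (hg : ContinuousOn g Ω)
    (hconf : ∀ᵐ p : ℝ × ℝ, p ∈ regularSet Ω g →
      ∃ c : ℝ, 0 < c ∧ ∃ Q ∈ Matrix.orthogonalGroup (Fin 2) ℝ, matrixD α g p = c • Q)
    (horient : ∀ᵐ p : ℝ × ℝ, p ∈ Ω → 0 < (matrixDH α g p).det) :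
    ∀ᵐ p ∂(volume : Measure (ℝ × ℝ)).restrict (Icc a b ×ˢ Icc c d),
      |(g p).1| ^ α * partialX (fun z => (g z).1) p =
        |p.1| ^ α * partialY (fun z => (g z).2) p ∧
      |p.1| ^ α * (|(g p).1| ^ α * partialY (fun z => (g z).1) p) =
        -partialX (fun z => (g z).2) p := by
  have hRm : MeasurableSet (Icc a b ×ˢ Icc c d) := measurableSet_Icc.prod measurableSet_Icc
  filter_upwards [ae_restrict_of_ae hconf, ae_restrict_mem hRm,
    ae_ne_zero_of_orientationPreserving hα hR hab hcd hg horient] with p hp hpR ⟨hx, hg1, hdet⟩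
  obtain ⟨k, hk, Q, hQ, hD⟩ := hp ⟨hR hpR, fun hS => hS.2.elim hx hg1⟩
  have hpos : 0 < |(g p).1| ^ α := Real.rpow_pos_of_pos (abs_pos.2 hg1) _
  have h00 := congrFun (congrFun hD 0) 0
  have h01 := congrFun (congrFun hD 0) 1
  have h10 := congrFun (congrFun hD 1) 0
  have h11 := congrFun (congrFun hD 1) 1
  simp [matrixD] at h00 h01 h10 h11
  rw [div_eq_iff hpos.ne'] at h10 h11
  have hdQ : 0 < Q.det := by
    simp only [matrixDH, Matrix.det_fin_two_of, h00, h01, h10, h11] at hdet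
    rw [Matrix.det_fin_two]
    have h3 : 0 < (k * k * |(g p).1| ^ α) * (Q 0 0 * Q 1 1 - Q 0 1 * Q 1 0) := by
      calc _ < _ := hdet
        _ = _ := by ring
    exact (pos_iff_pos_of_mul_pos h3).1 (by positivity)
  obtain ⟨e1, e2⟩ := Matrix.eq_of_mem_orthogonalGroup_of_det_pos hQ hdQ
  simp only [fieldY] at h01 h11
  constructor
  · rw [h00, h11, e1]; ring
  · rw [h10]
    linear_combination |(g p).1| ^ α * h01 + k * |(g p).1| ^ α * e2

/-- The map `g` read in the coordinate `toComplex`. -/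
noncomputable def complexConj (hα : 0 < α) (g : ℝ × ℝ → ℝ × ℝ) (w : ℂ) : ℂ :=
  toComplex hα (g ((toComplex hα).symm w))

theorem complexConj_toComplex (hα : 0 < α) (g : ℝ × ℝ → ℝ × ℝ) (p : ℝ × ℝ) :
    complexConj hα g (toComplex hα p) = toComplex hα (g p) := by
  simp [complexConj]

theorem continuousOn_complexConj (hα : 0 < α) (hg : ContinuousOn g Ω) :
    ContinuousOn (complexConj hα g) (toComplex hα '' Ω) := by
  refine (toComplex hα).continuous.comp_continuousOn
    (hg.comp (toComplex hα).symm.continuous.continuousOn ?_)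
  rintro _ ⟨p, hp, rfl⟩
  simpa using hp

theorem integral_ofReal_add_mul_I {u v : ℝ → ℝ} (hu : IntervalIntegrable u volume a b)
    (hv : IntervalIntegrable v volume a b) :
    ∫ x in a..b, ((u x : ℂ) + v x * Complex.I) =
      ((∫ x in a..b, u x : ℝ) : ℂ) + ((∫ x in a..b, v x : ℝ) : ℂ) * Complex.I := by
  rw [intervalIntegral.integral_add, intervalIntegral.integral_mul_const,
    intervalIntegral.integral_ofReal, intervalIntegral.integral_ofReal]
  · exact ⟨hu.1.ofReal, hu.2.ofReal⟩
  · exact IntervalIntegrable.mul_const ⟨hv.1.ofReal, hv.2.ofReal⟩ _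

theorem complexConj_flatten (hα : 0 < α) (g : ℝ × ℝ → ℝ × ℝ) (x y : ℝ) :
    complexConj hα g (flatten α x + y * Complex.I) =
      (flatten α (g (x, y)).1 : ℂ) + (g (x, y)).2 * Complex.I := by
  have : (flatten α x + y * Complex.I : ℂ) = toComplex hα (x, y) := by
    rw [toComplex_apply]; apply Complex.ext <;> simp
  rw [this, complexConj_toComplex, toComplex_apply]
  apply Complex.ext <;> simp

/-- Differences over opposite sides become double integrals: `e1` and `e4` are matched by the first
Cauchy–Riemann equation and give the imaginary part, `e2` and `e3` by the second and give the real
part. The weight |x|^α is the Jacobian of x ↦ s, so the rectangle may cross the singular line. -/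
theorem integral_boundary_rect_complexConj (hα : 0 < α) (hΩ : IsOpen Ω)
    (hR : Icc a b ×ˢ Icc c d ⊆ Ω) (hab : a < b) (hcd : c < d) (hg : ContinuousOn g Ω)
    {v₁ w₁ v₂ w₂ : ℝ × ℝ → ℝ}
    (hv₁ : HasWeakPartialX Ω (fun p => (g p).1) v₁) (hw₁ : HasWeakPartialY Ω (fun p => (g p).1) w₁)
    (hv₂ : HasWeakPartialX Ω (fun p => (g p).2) v₂) (hw₂ : HasWeakPartialY Ω (fun p => (g p).2) w₂)
    (hconf : ∀ᵐ p : ℝ × ℝ, p ∈ regularSet Ω g →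
      ∃ c : ℝ, 0 < c ∧ ∃ Q ∈ Matrix.orthogonalGroup (Fin 2) ℝ, matrixD α g p = c • Q)
    (horient : ∀ᵐ p : ℝ × ℝ, p ∈ Ω → 0 < (matrixDH α g p).det) :
    (∫ x in flatten α a..flatten α b, complexConj hα g (x + c * Complex.I)) -
      (∫ x in flatten α a..flatten α b, complexConj hα g (x + d * Complex.I)) +
      Complex.I • (∫ y in c..d, complexConj hα g (flatten α b + y * Complex.I)) -
      Complex.I • (∫ y in c..d, complexConj hα g (flatten α a + y * Complex.I)) = 0 := by
  have hRc : IsCompact (Icc a b ×ˢ Icc c d) := isCompact_Icc.prod isCompact_Icc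
  have hg1 : ContinuousOn (fun p => (g p).1) (Icc a b ×ˢ Icc c d) :=
    continuous_fst.comp_continuousOn (hg.mono hR)
  have hg2 : ContinuousOn (fun p => (g p).2) (Icc a b ×ˢ Icc c d) :=
    continuous_snd.comp_continuousOn (hg.mono hR)
  have hF1 : ContinuousOn (fun p => flatten α (g p).1) (Icc a b ×ˢ Icc c d) :=
    (continuous_flatten hα).comp_continuousOn hg1
  have hint : ∀ {w : ℝ × ℝ → ℝ}, LocallyIntegrableOn w Ω → IntegrableOn w (Icc a b ×ˢ Icc c d) :=
    fun hw => hw.integrableOn_compact_subset hR hRc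
  have hm := continuous_abs_rpow hα
  obtain ⟨i1, e1⟩ := integral_sub_eq_integral_partialX hΩ hR hab hcd hg1 (hint hv₁.2.1) hv₁.2.2
    (hasDerivAt_flatten hα) hm (m := fun _ => 1) continuous_const
  obtain ⟨i2, e2⟩ := integral_sub_eq_integral_partialX hΩ hR hab hcd hg2 (hint hv₂.2.1) hv₂.2.2
    (Ψ := fun x => x) (ψ := fun _ => 1) hasDerivAt_id' continuous_const
    (m := fun _ => 1) continuous_const
  obtain ⟨i3, e3⟩ := integral_sub_eq_integral_partialY hΩ hR hab hcd hg1 (hint hw₁.2.1) hw₁.2.2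
    (hasDerivAt_flatten hα) hm hm
  obtain ⟨i4, e4⟩ := integral_sub_eq_integral_partialY hΩ hR hab hcd hg2 (hint hw₂.2.1) hw₂.2.2
    (Ψ := fun x => x) (ψ := fun _ => 1) hasDerivAt_id' continuous_const hm
  have hCR := ae_cauchyRiemann hα hR hab hcd hg hconf horient
  have r1 : ∫ p in Icc a b ×ˢ Icc c d, 1 * (|(g p).1| ^ α * partialX (fun z => (g z).1) p) =
      ∫ p in Icc a b ×ˢ Icc c d, |p.1| ^ α * (1 * partialY (fun z => (g z).2) p) := by
    refine integral_congr_ae ?_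
    filter_upwards [hCR] with p hp
    rw [one_mul, one_mul, hp.1]
  have r2 : ∫ p in Icc a b ×ˢ Icc c d, 1 * (1 * partialX (fun z => (g z).2) p) =
      -∫ p in Icc a b ×ˢ Icc c d, |p.1| ^ α * (|(g p).1| ^ α * partialY (fun z => (g z).1) p) := by
    rw [← integral_neg]
    refine integral_congr_ae ?_
    filter_upwards [hCR] with p hp
    rw [one_mul, one_mul, hp.2, neg_neg]
  have hrow : ∀ {k : ℝ × ℝ → ℝ}, ContinuousOn k (Icc a b ×ˢ Icc c d) → ∀ y ∈ Icc c d,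
      IntervalIntegrable (fun x => |x| ^ α * k (x, y)) volume a b := by
    intro k hk y hy
    refine ContinuousOn.intervalIntegrable ?_
    rw [uIcc_of_le hab.le]
    exact hm.continuousOn.mul (continuousOn_slice hk hy)
  have hcol : ∀ {k : ℝ × ℝ → ℝ}, ContinuousOn k (Icc a b ×ˢ Icc c d) → ∀ x ∈ Icc a b,
      IntervalIntegrable (fun y => k (x, y)) volume c d := by
    intro k hk x hx
    refine ContinuousOn.intervalIntegrable ?_
    rw [uIcc_of_le hcd.le]
    exact hk.comp (by fun_prop) fun y hy => ⟨hx, hy⟩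
  have hsubst : ∀ y ∈ Icc c d,
      ∫ x in flatten α a..flatten α b, complexConj hα g (x + y * Complex.I) =
      ((∫ x in a..b, |x| ^ α * flatten α (g (x, y)).1 : ℝ) : ℂ) +
        ((∫ x in a..b, |x| ^ α * (g (x, y)).2 : ℝ) : ℂ) * Complex.I := by
    intro y hy
    have hc : ContinuousOn (fun x : ℝ => complexConj hα g (x + y * Complex.I))
        (flatten α '' uIcc a b) := by
      refine (continuousOn_complexConj hα hg).comp (by fun_prop) ?_
      rintro _ ⟨x, hx, rfl⟩
      rw [uIcc_of_le hab.le] at hx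
      refine ⟨(x, y), hR ⟨hx, hy⟩, ?_⟩
      rw [toComplex_apply]; apply Complex.ext <;> simp
    rw [← intervalIntegral.integral_deriv_smul_comp' (fun x _ => hasDerivAt_flatten hα x)
      hm.continuousOn hc,
      ← integral_ofReal_add_mul_I (hrow hF1 y hy) (hrow hg2 y hy)]
    refine intervalIntegral.integral_congr fun x _ => ?_
    simp only [Function.comp, complexConj_flatten, Complex.real_smul]
    push_cast
    ring
  have hvert : ∀ x ∈ Icc a b,
      ∫ y in c..d, complexConj hα g (flatten α x + y * Complex.I) =
      ((∫ y in c..d, flatten α (g (x, y)).1 : ℝ) : ℂ) +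
        ((∫ y in c..d, (g (x, y)).2 : ℝ) : ℂ) * Complex.I := by
    intro x hx
    rw [← integral_ofReal_add_mul_I (hcol hF1 x hx) (hcol hg2 x hx)]
    exact intervalIntegral.integral_congr fun y _ => complexConj_flatten hα g x y
  have hac := left_mem_Icc.2 hab.le
  have hbc := right_mem_Icc.2 hab.le
  have hcc := left_mem_Icc.2 hcd.le
  have hdc := right_mem_Icc.2 hcd.le
  rw [hsubst c hcc, hsubst d hdc, hvert a hac, hvert b hbc]
  simp only [one_mul, mul_sub] at e1 e2 e3 e4 r1 r2
  rw [intervalIntegral.integral_sub (hcol hF1 b hbc) (hcol hF1 a hac)] at e1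
  rw [intervalIntegral.integral_sub (hcol hg2 b hbc) (hcol hg2 a hac)] at e2
  rw [intervalIntegral.integral_sub (hrow hF1 d hdc) (hrow hF1 c hcc)] at e3
  rw [intervalIntegral.integral_sub (hrow hg2 d hdc) (hrow hg2 c hcc)] at e4
  apply Complex.ext
  · simp
    linarith
  · simp
    linarith

theorem IsConformal.continuousOn (hconf : IsConformal α Ω Ω' g) : ContinuousOn g Ω := by
  obtain ⟨e, he⟩ := hconf.homeo
  rw [continuousOn_iff_continuous_domRestrict]
  exact (continuous_subtype_val.comp e.continuous).congr he

theorem IsConformal.injOn (hconf : IsConformal α Ω Ω' g) : InjOn g Ω := by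
  obtain ⟨e, he⟩ := hconf.homeo
  intro p hp q hq hpq
  have : e ⟨p, hp⟩ = e ⟨q, hq⟩ := Subtype.ext (by rw [he, he]; exact hpq)
  exact congrArg Subtype.val (e.injective this)

theorem isConservativeOn_complexConj {q : ℝ} (hα : 0 < α) (hΩ : IsOpen Ω)
    (hg : MemHWMap α q Ω Ω' g) (hconf : IsConformal α Ω Ω' g)
    (horient : OrientationPreserving α Ω Ω' g) :
    Complex.IsConservativeOn (complexConj hα g) (toComplex hα '' Ω) := by
  obtain ⟨-, ⟨-, v₁, w₁, hv₁, hw₁, -, -⟩, ⟨-, v₂, w₂, hv₂, hw₂, -, -⟩⟩ := hg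
  intro z w hzw
  rw [← add_eq_zero_iff_eq_neg, Complex.wedgeIntegral_add_wedgeIntegral_eq]
  have key : ∀ {a b c d : ℝ}, a < b → c < d →
      [[flatten α a, flatten α b]] ×ℂ [[c, d]] ⊆ toComplex hα '' Ω →
      (∫ x in flatten α a..flatten α b, complexConj hα g (x + c * Complex.I)) -
      (∫ x in flatten α a..flatten α b, complexConj hα g (x + d * Complex.I)) +
      Complex.I • (∫ y in c..d, complexConj hα g (flatten α b + y * Complex.I)) -
      Complex.I • (∫ y in c..d, complexConj hα g (flatten α a + y * Complex.I)) = 0 := by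
    intro a b c d hab hcd hsub
    refine integral_boundary_rect_complexConj hα hΩ ?_ hab hcd hconf.continuousOn hv₁ hw₁ hv₂ hw₂
      hconf.conformal_ae horient.2
    rintro ⟨x, y⟩ ⟨hx, hy⟩
    have hmem : toComplex hα (x, y) ∈ [[flatten α a, flatten α b]] ×ℂ [[c, d]] := by
      rw [toComplex_apply, Complex.mem_reProdIm, uIcc_of_le (strictMono_flatten hα hab).le,
        uIcc_of_le hcd.le]
      exact ⟨⟨(strictMono_flatten hα).monotone hx.1, (strictMono_flatten hα).monotone hx.2⟩, hy⟩
    obtain ⟨p, hp, hpe⟩ := hsub hmem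
    rwa [← (toComplex hα).injective hpe]
  -- Every rectangle of ℂ comes from a rectangle in (x, y); the remaining cases only reverse
  -- orientations or are degenerate.
  obtain ⟨a, ha⟩ := surjective_flatten hα z.re
  obtain ⟨b, hb⟩ := surjective_flatten hα w.re
  have hsub : [[flatten α a, flatten α b]] ×ℂ [[z.im, w.im]] ⊆ toComplex hα '' Ω := by
    rw [ha, hb]; exact hzw
  rw [← ha, ← hb]
  generalize z.im = c at hsub ⊢
  generalize w.im = d at hsub ⊢
  rcases lt_trichotomy a b with hab | rfl | hab
  · rcases lt_trichotomy c d with hcd | rfl | hcd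
    · exact key hab hcd hsub
    · simp
    · have := key hab hcd (by rwa [uIcc_comm d c])
      rw [intervalIntegral.integral_symm d c, intervalIntegral.integral_symm d c]
      simp only [smul_eq_mul] at this ⊢
      linear_combination -this
  · simp
  · rw [intervalIntegral.integral_symm (flatten α b), intervalIntegral.integral_symm (flatten α b)]
    rcases lt_trichotomy c d with hcd | rfl | hcd
    · have := key hab hcd (by rwa [uIcc_comm])
      simp only [smul_eq_mul] at this ⊢
      linear_combination -this
    · simp
    · have := key hab hcd (by rwa [uIcc_comm, uIcc_comm d c])
      rw [intervalIntegral.integral_symm d c, intervalIntegral.integral_symm d c]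
      simp only [smul_eq_mul] at this ⊢
      linear_combination this

theorem isOpen_image_toComplex (hα : 0 < α) (hΩ : IsOpen Ω) : IsOpen (toComplex hα '' Ω) :=
  (toComplex hα).isOpenMap Ω hΩ

/-- A conformal orientation preserving map of the Grushin plane is holomorphic in the coordinate
`toComplex`. -/
theorem differentiableOn_complexConj {q : ℝ} (hα : 0 < α) (hΩ : IsOpen Ω)
    (hg : MemHWMap α q Ω Ω' g) (hconf : IsConformal α Ω Ω' g)
    (horient : OrientationPreserving α Ω Ω' g) :
    DifferentiableOn ℂ (complexConj hα g) (toComplex hα '' Ω) := by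
  intro w hw
  obtain ⟨r, hr, hball⟩ := Metric.isOpen_iff.1 (isOpen_image_toComplex hα hΩ) w hw
  have h1 := ((isConservativeOn_complexConj hα hΩ hg hconf horient).mono hball).isExactOn_ball
    ((continuousOn_complexConj hα hconf.continuousOn).mono hball)
  have h2 := h1.differentiableOn Metric.isOpen_ball
  exact (h2.differentiableAt (Metric.ball_mem_nhds w hr)).differentiableWithinAt

theorem deriv_complexConj_ne_zero {q : ℝ} (hα : 0 < α) (hΩ : IsOpen Ω)
    (hg : MemHWMap α q Ω Ω' g) (hconf : IsConformal α Ω Ω' g)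
    (horient : OrientationPreserving α Ω Ω' g) {p : ℝ × ℝ} (hp : p ∈ Ω) :
    deriv (complexConj hα g) (toComplex hα p) ≠ 0 := by
  refine Complex.deriv_ne_zero_of_injOn (isOpen_image_toComplex hα hΩ)
    (differentiableOn_complexConj hα hΩ hg hconf horient) ?_ (mem_image_of_mem _ hp)
  rintro _ ⟨x, hx, rfl⟩ _ ⟨y, hy, rfl⟩ hxy
  rw [complexConj_toComplex, complexConj_toComplex] at hxy
  rw [hconf.injOn hx hy ((toComplex hα).injective hxy)]

end Grushin

/-! ### The differential of g and its conformal factor. -/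

namespace Grushin

variable {α : ℝ} {Ω Ω' : Set (ℝ × ℝ)} {g : ℝ × ℝ → ℝ × ℝ}

/-- The complex derivative at `p` of `g` read in the coordinate `toComplex`. -/
noncomputable def complexDeriv (hα : 0 < α) (g : ℝ × ℝ → ℝ × ℝ) (p : ℝ × ℝ) : ℂ :=
  deriv (complexConj hα g) (toComplex hα p)

/-- The conformal factor of `g` with respect to the Grushin metric. -/
noncomputable def conformalFactor (hα : 0 < α) (g : ℝ × ℝ → ℝ × ℝ) (p : ℝ × ℝ) : ℝ :=
  |p.1| ^ α / |(g p).1| ^ α * ‖complexDeriv hα g p‖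

theorem hasStrictFDerivAt_toComplex (hα : 0 < α) (p : ℝ × ℝ) :
    HasStrictFDerivAt (fun q : ℝ × ℝ => (toComplex hα q))
      ((|p.1| ^ α) • (Complex.ofRealCLM.comp (ContinuousLinearMap.fst ℝ ℝ ℝ)) +
        Complex.I • (Complex.ofRealCLM.comp (ContinuousLinearMap.snd ℝ ℝ ℝ))) p := by
  have h1 : HasStrictFDerivAt (fun q : ℝ × ℝ => flatten α q.1)
      ((|p.1| ^ α) • ContinuousLinearMap.fst ℝ ℝ ℝ) p :=
    (hasStrictDerivAt_flatten hα p.1).comp_hasStrictFDerivAt p hasStrictFDerivAt_fst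
  have h2 := (Complex.ofRealCLM.hasStrictFDerivAt.comp p h1).add
    ((Complex.ofRealCLM.hasStrictFDerivAt.comp p
      (hasStrictFDerivAt_snd (𝕜 := ℝ) (E := ℝ) (F := ℝ))).const_smul Complex.I)
  refine (h2.congr_fderiv ?_).congr_of_eventuallyEq (.of_forall fun q => ?_)
  · ext <;> simp
  · simp only [toComplex_apply, Pi.add_apply, Pi.smul_apply]
    apply Complex.ext <;> simp

theorem hasStrictDerivAt_complexConj (hα : 0 < α) (hΩ : IsOpen Ω)
    (hd : DifferentiableOn ℂ (complexConj hα g) (toComplex hα '' Ω)) {p : ℝ × ℝ} (hp : p ∈ Ω) :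
    HasStrictDerivAt (complexConj hα g) (complexDeriv hα g p) (toComplex hα p) :=
  (hd.analyticAt ((isOpen_image_toComplex hα hΩ).mem_nhds
    (mem_image_of_mem _ hp))).hasStrictDerivAt

theorem hasStrictFDerivAt_toComplex_comp (hα : 0 < α) (hΩ : IsOpen Ω)
    (hd : DifferentiableOn ℂ (complexConj hα g) (toComplex hα '' Ω)) {p : ℝ × ℝ} (hp : p ∈ Ω) :
    HasStrictFDerivAt (fun q => toComplex hα (g q))
      (complexDeriv hα g p • ((|p.1| ^ α) • (Complex.ofRealCLM.comp (ContinuousLinearMap.fst ℝ ℝ ℝ)) +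
        Complex.I • (Complex.ofRealCLM.comp (ContinuousLinearMap.snd ℝ ℝ ℝ)))) p := by
  have h1 := (hasStrictDerivAt_complexConj hα hΩ hd hp).hasStrictFDerivAt.restrictScalars ℝ
  have h2 := h1.comp p (hasStrictFDerivAt_toComplex hα p)
  refine (h2.congr_fderiv ?_).congr_of_eventuallyEq (.of_forall fun q => ?_)
  · ext <;> simp [mul_comm]
  · exact complexConj_toComplex hα g q

theorem hasStrictFDerivAt_snd_map (hα : 0 < α) (hΩ : IsOpen Ω)
    (hd : DifferentiableOn ℂ (complexConj hα g) (toComplex hα '' Ω)) {p : ℝ × ℝ} (hp : p ∈ Ω) :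
    HasStrictFDerivAt (fun q => (g q).2)
      ((|p.1| ^ α * (complexDeriv hα g p).im) • ContinuousLinearMap.fst ℝ ℝ ℝ +
        (complexDeriv hα g p).re • ContinuousLinearMap.snd ℝ ℝ ℝ) p := by
  have h1 := Complex.imCLM.hasStrictFDerivAt.comp p (hasStrictFDerivAt_toComplex_comp hα hΩ hd hp)
  refine (h1.congr_fderiv ?_).congr_of_eventuallyEq (.of_forall fun q => ?_)
  · ext <;> simp [mul_comm]
  · simp [toComplex_apply]

/-- Unlike g₂ = Im F, the component g₁ requires inverting `flatten α`, whose derivative vanishes at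
0; hence the hypothesis g₁ ≠ 0. -/
theorem hasStrictFDerivAt_fst_map (hα : 0 < α) (hΩ : IsOpen Ω)
    (hd : DifferentiableOn ℂ (complexConj hα g) (toComplex hα '' Ω)) {p : ℝ × ℝ} (hp : p ∈ Ω)
    (hg0 : (g p).1 ≠ 0) :
    HasStrictFDerivAt (fun q => (g q).1)
      ((|p.1| ^ α / |(g p).1| ^ α * (complexDeriv hα g p).re) • ContinuousLinearMap.fst ℝ ℝ ℝ +
        (-(complexDeriv hα g p).im / |(g p).1| ^ α) • ContinuousLinearMap.snd ℝ ℝ ℝ) p := by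
  have h1 := Complex.reCLM.hasStrictFDerivAt.comp p (hasStrictFDerivAt_toComplex_comp hα hΩ hd hp)
  have h0 : (Complex.reCLM ∘ fun q => toComplex hα (g q)) p = flatten α (g p).1 := by
    simp [toComplex_apply]
  have h2 := hasStrictDerivAt_flattenHomeo_symm hα hg0
  rw [← h0] at h2
  have h3 := h2.comp_hasStrictFDerivAt p h1
  refine (h3.congr_fderiv ?_).congr_of_eventuallyEq (.of_forall fun q => ?_)
  · ext <;> simp <;> ring
  · simp only [Function.comp, toComplex_apply, Complex.reCLM_apply]
    exact (flattenHomeo hα).symm_apply_apply _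

theorem hasDerivAt_partials_of_hasFDerivAt {f : ℝ × ℝ → ℝ} {A B : ℝ} {p : ℝ × ℝ}
    (hf : HasFDerivAt f (A • ContinuousLinearMap.fst ℝ ℝ ℝ + B • ContinuousLinearMap.snd ℝ ℝ ℝ) p) :
    HasDerivAt (fun s => f (s, p.2)) A p.1 ∧ HasDerivAt (fun s => f (p.1, s)) B p.2 := by
  constructor
  · have h1 : HasDerivAt (fun s : ℝ => (s, p.2)) ((1 : ℝ), (0 : ℝ)) p.1 :=
      (hasDerivAt_id _).prodMk (hasDerivAt_const _ _)
    exact (hf.comp_hasDerivAt p.1 h1).congr_deriv (by simp)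
  · have h1 : HasDerivAt (fun s : ℝ => (p.1, s)) ((0 : ℝ), (1 : ℝ)) p.2 :=
      (hasDerivAt_const _ _).prodMk (hasDerivAt_id _)
    exact (hf.comp_hasDerivAt p.2 h1).congr_deriv (by simp)

theorem matrixD_eq (hα : 0 < α) (hΩ : IsOpen Ω)
    (hd : DifferentiableOn ℂ (complexConj hα g) (toComplex hα '' Ω)) {p : ℝ × ℝ} (hp : p ∈ Ω)
    (hg0 : (g p).1 ≠ 0) :
    matrixD α g p = (|p.1| ^ α / |(g p).1| ^ α) •
      !![(complexDeriv hα g p).re, -(complexDeriv hα g p).im;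
        (complexDeriv hα g p).im, (complexDeriv hα g p).re] := by
  obtain ⟨hx1, hy1⟩ :=
    hasDerivAt_partials_of_hasFDerivAt (hasStrictFDerivAt_fst_map hα hΩ hd hp hg0).hasFDerivAt
  obtain ⟨hx2, hy2⟩ :=
    hasDerivAt_partials_of_hasFDerivAt (hasStrictFDerivAt_snd_map hα hΩ hd hp).hasFDerivAt
  ext i j
  fin_cases i <;> fin_cases j <;>
    simp [matrixD, fieldY, partialX, partialY, hx1.deriv, hx2.deriv, hy1.deriv, hy2.deriv] <;> ring

theorem continuousAt_complexDeriv (hα : 0 < α) (hΩ : IsOpen Ω)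
    (hd : DifferentiableOn ℂ (complexConj hα g) (toComplex hα '' Ω)) {p : ℝ × ℝ} (hp : p ∈ Ω) :
    ContinuousAt (complexDeriv hα g) p := by
  have h1 : ContinuousAt (deriv (complexConj hα g)) (toComplex hα p) :=
    (hd.analyticAt ((isOpen_image_toComplex hα hΩ).mem_nhds
      (mem_image_of_mem _ hp))).deriv.continuousAt
  exact h1.comp (toComplex hα).continuous.continuousAt

/-- R_g has full measure in every small square, hence is dense in Ω. This makes limits along R_g
unique. -/
theorem neBot_nhdsWithin_regularSet (hα : 0 < α) (hΩ : IsOpen Ω) (hg : ContinuousOn g Ω)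
    (horient : ∀ᵐ p : ℝ × ℝ, p ∈ Ω → 0 < (matrixDH α g p).det) {p : ℝ × ℝ} (hp : p ∈ Ω) :
    (𝓝[regularSet Ω g] p).NeBot := by
  rw [← mem_closure_iff_nhdsWithin_neBot, Metric.mem_closure_iff]
  intro ε hε
  obtain ⟨r, hr, hball⟩ := Metric.isOpen_iff.1 hΩ p hp
  set s := min ε r / 2 with hs
  have hs0 : 0 < s := by positivity
  have hsub : Icc (p.1 - s) (p.1 + s) ×ˢ Icc (p.2 - s) (p.2 + s) ⊆ Metric.ball p (min ε r) := by
    rw [← Real.closedBall_eq_Icc, ← Real.closedBall_eq_Icc, closedBall_prod_same]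
    exact Metric.closedBall_subset_ball (by rw [hs]; linarith [lt_min hε hr])
  have hsub' := hsub.trans ((Metric.ball_subset_ball (min_le_right _ _)).trans hball)
  have hae := ae_ne_zero_of_orientationPreserving hα hsub' (by linarith) (by linarith) hg horient
  have hm : MeasurableSet (Icc (p.1 - s) (p.1 + s) ×ˢ Icc (p.2 - s) (p.2 + s)) :=
    measurableSet_Icc.prod measurableSet_Icc
  have hpos : (volume : Measure (ℝ × ℝ)).restrict
      (Icc (p.1 - s) (p.1 + s) ×ˢ Icc (p.2 - s) (p.2 + s)) ≠ 0 := by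
    rw [Ne, Measure.restrict_eq_zero, Measure.volume_eq_prod, Measure.prod_prod, mul_eq_zero,
      Real.volume_Icc, Real.volume_Icc, ENNReal.ofReal_eq_zero, ENNReal.ofReal_eq_zero]
    rintro (h | h) <;> linarith
  have := ae_neBot.2 hpos
  obtain ⟨q, ⟨hq1, hq2, -⟩, hqm⟩ := (hae.and (ae_restrict_mem hm)).exists
  refine ⟨q, ⟨hsub' hqm, fun hS => hS.2.elim hq1 hq2⟩, ?_⟩
  rw [dist_comm]
  exact (hsub hqm).trans_le (min_le_left _ _)

theorem ne_zero_of_mem_regularSet {p : ℝ × ℝ} (hp : p ∈ regularSet Ω g) :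
    p.1 ≠ 0 ∧ (g p).1 ≠ 0 :=
  ⟨fun h => hp.2 ⟨hp.1, Or.inl h⟩, fun h => hp.2 ⟨hp.1, Or.inr h⟩⟩

/-- λ is the norm of the first column of D_α g. The limit L inherits the form of a multiple of a
rotation, so L ≠ 0 forces its first column to be nonzero. -/
theorem tendsto_conformalFactor_of_mem_singularSet (hα : 0 < α) (hΩ : IsOpen Ω)
    (hg : ContinuousOn g Ω)
    (horient : ∀ᵐ p : ℝ × ℝ, p ∈ Ω → 0 < (matrixDH α g p).det)
    (hlim : ∀ p₀ ∈ singularSet Ω g, ∃ L : Matrix (Fin 2) (Fin 2) ℝ, L ≠ 0 ∧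
      Tendsto (matrixD α g) (𝓝[regularSet Ω g] p₀) (𝓝 L))
    (hd : DifferentiableOn ℂ (complexConj hα g) (toComplex hα '' Ω))
    {p₀ : ℝ × ℝ} (hp₀ : p₀ ∈ singularSet Ω g) :
    ∃ l : ℝ, 0 < l ∧ Tendsto (conformalFactor hα g) (𝓝[regularSet Ω g] p₀) (𝓝 l) := by
  obtain ⟨L, hL0, hL⟩ := hlim p₀ hp₀
  have := neBot_nhdsWithin_regularSet hα hΩ hg horient hp₀.1
  have hent : ∀ i j, Tendsto (fun p => matrixD α g p i j) (𝓝[regularSet Ω g] p₀) (𝓝 (L i j)) :=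
    fun i j => ((continuous_apply_apply i j).tendsto L).comp hL
  have hD : ∀ᶠ p in 𝓝[regularSet Ω g] p₀, matrixD α g p = (|p.1| ^ α / |(g p).1| ^ α) •
      !![(complexDeriv hα g p).re, -(complexDeriv hα g p).im;
        (complexDeriv hα g p).im, (complexDeriv hα g p).re] := by
    filter_upwards [self_mem_nhdsWithin] with p hp
    exact matrixD_eq hα hΩ hd hp.1 (ne_zero_of_mem_regularSet hp).2
  have e1 : L 1 1 = L 0 0 := by
    refine tendsto_nhds_unique (hent 1 1) ((hent 0 0).congr' ?_)
    filter_upwards [hD] with p hp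
    rw [hp]; simp
  have e2 : L 0 1 = -L 1 0 := by
    refine tendsto_nhds_unique (hent 0 1) ((hent 1 0).neg.congr' ?_)
    filter_upwards [hD] with p hp
    rw [hp]; simp
  have hpos : 0 < L 0 0 ^ 2 + L 1 0 ^ 2 := by
    by_contra hcon
    have h0 : L 0 0 = 0 := by nlinarith [sq_nonneg (L 0 0), sq_nonneg (L 1 0)]
    have h1 : L 1 0 = 0 := by nlinarith [sq_nonneg (L 0 0), sq_nonneg (L 1 0)]
    refine hL0 ?_
    ext i j
    fin_cases i <;> fin_cases j <;> simp [e1, e2, h0, h1]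
  refine ⟨√(L 0 0 ^ 2 + L 1 0 ^ 2), Real.sqrt_pos.2 hpos, ?_⟩
  have h1 := (((hent 0 0).pow 2).add ((hent 1 0).pow 2)).sqrt
  refine h1.congr' ?_
  filter_upwards [hD] with p hp
  rw [hp, conformalFactor, Complex.norm_def, Complex.normSq_apply,
    ← Real.sqrt_sq (show 0 ≤ |p.1| ^ α / |(g p).1| ^ α by positivity), ← Real.sqrt_mul (sq_nonneg _)]
  congr 1
  rw [Real.sqrt_sq (by positivity)]
  simp
  ring

theorem fst_eq_zero_of_mem_singularSet (hα : 0 < α) (hΩ : IsOpen Ω)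
    (hg : ContinuousOn g Ω)
    (horient : ∀ᵐ p : ℝ × ℝ, p ∈ Ω → 0 < (matrixDH α g p).det)
    (hlim : ∀ p₀ ∈ singularSet Ω g, ∃ L : Matrix (Fin 2) (Fin 2) ℝ, L ≠ 0 ∧
      Tendsto (matrixD α g) (𝓝[regularSet Ω g] p₀) (𝓝 L))
    (hd : DifferentiableOn ℂ (complexConj hα g) (toComplex hα '' Ω))
    (hne : ∀ p ∈ Ω, complexDeriv hα g p ≠ 0)
    {p₀ : ℝ × ℝ} (hp₀ : p₀ ∈ singularSet Ω g) : p₀.1 = 0 ∧ (g p₀).1 = 0 := by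
  obtain ⟨l, hl, ht⟩ := tendsto_conformalFactor_of_mem_singularSet hα hΩ hg horient hlim hd hp₀
  have := neBot_nhdsWithin_regularSet hα hΩ hg horient hp₀.1
  have hc := continuous_abs_rpow hα
  have hgc : ContinuousAt g p₀ := hg.continuousAt (hΩ.mem_nhds hp₀.1)
  have h1 : Tendsto (fun p => |(g p).1| ^ α) (𝓝[regularSet Ω g] p₀) (𝓝 (|(g p₀).1| ^ α)) :=
    ((hc.comp continuous_fst).continuousAt.comp hgc).mono_left nhdsWithin_le_nhds
  have h2 : Tendsto (fun p : ℝ × ℝ => |p.1| ^ α) (𝓝[regularSet Ω g] p₀) (𝓝 (|p₀.1| ^ α)) :=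
    ((hc.comp continuous_fst).tendsto p₀).mono_left nhdsWithin_le_nhds
  have h3 : Tendsto (fun p => ‖complexDeriv hα g p‖) (𝓝[regularSet Ω g] p₀)
      (𝓝 ‖complexDeriv hα g p₀‖) :=
    (continuousAt_complexDeriv hα hΩ hd hp₀.1).norm.mono_left nhdsWithin_le_nhds
  -- The limit of λ|g₁|^α = |x|^α|F'|. Since l and F' are nonzero, x and g₁ vanish together at p₀.
  have heq : l * |(g p₀).1| ^ α = |p₀.1| ^ α * ‖complexDeriv hα g p₀‖ := by
    refine tendsto_nhds_unique (ht.mul h1) ((h2.mul h3).congr' ?_)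
    filter_upwards [self_mem_nhdsWithin] with p hp
    have : |(g p).1| ^ α ≠ 0 :=
      (Real.rpow_pos_of_pos (abs_pos.2 (ne_zero_of_mem_regularSet hp).2) _).ne'
    rw [conformalFactor]
    field_simp
  have hn : ‖complexDeriv hα g p₀‖ ≠ 0 := norm_ne_zero_iff.2 (hne p₀ hp₀.1)
  rcases hp₀.2 with h0 | h0
  · refine ⟨h0, ?_⟩
    rw [h0, abs_zero, Real.zero_rpow hα.ne', zero_mul, mul_eq_zero] at heq
    have := heq.resolve_left hl.ne'
    rwa [Real.rpow_eq_zero (abs_nonneg _) hα.ne', abs_eq_zero] at this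
  · refine ⟨?_, h0⟩
    rw [h0, abs_zero, Real.zero_rpow hα.ne', mul_zero, eq_comm, mul_eq_zero] at heq
    have := heq.resolve_right hn
    rwa [Real.rpow_eq_zero (abs_nonneg _) hα.ne', abs_eq_zero] at this

theorem exists_tendsto_conformalFactor (hα : 0 < α) (hΩ : IsOpen Ω)
    (hg : ContinuousOn g Ω)
    (horient : ∀ᵐ p : ℝ × ℝ, p ∈ Ω → 0 < (matrixDH α g p).det)
    (hlim : ∀ p₀ ∈ singularSet Ω g, ∃ L : Matrix (Fin 2) (Fin 2) ℝ, L ≠ 0 ∧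
      Tendsto (matrixD α g) (𝓝[regularSet Ω g] p₀) (𝓝 L))
    (hd : DifferentiableOn ℂ (complexConj hα g) (toComplex hα '' Ω))
    (hne : ∀ p ∈ Ω, complexDeriv hα g p ≠ 0) {p₀ : ℝ × ℝ} (hp₀ : p₀ ∈ Ω) :
    ∃ l : ℝ, 0 < l ∧ Tendsto (conformalFactor hα g) (𝓝[regularSet Ω g] p₀) (𝓝 l) := by
  by_cases hS : p₀ ∈ singularSet Ω g
  · exact tendsto_conformalFactor_of_mem_singularSet hα hΩ hg horient hlim hd hS
  · obtain ⟨hx, hg0⟩ := ne_zero_of_mem_regularSet (g := g) ⟨hp₀, hS⟩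
    have hx' : 0 < |p₀.1| ^ α := Real.rpow_pos_of_pos (abs_pos.2 hx) _
    have hg0' : 0 < |(g p₀).1| ^ α := Real.rpow_pos_of_pos (abs_pos.2 hg0) _
    refine ⟨conformalFactor hα g p₀,
      mul_pos (div_pos hx' hg0') (norm_pos_iff.2 (hne p₀ hp₀)), ?_⟩
    have hc := continuous_abs_rpow hα
    have hgc : ContinuousAt g p₀ := hg.continuousAt (hΩ.mem_nhds hp₀)
    have h1 : ContinuousAt (fun p => |(g p).1| ^ α) p₀ :=
      (hc.comp continuous_fst).continuousAt.comp hgc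
    have h2 : ContinuousAt (fun p : ℝ × ℝ => |p.1| ^ α) p₀ := (hc.comp continuous_fst).continuousAt
    exact ((h2.div h1 hg0'.ne').mul
      (continuousAt_complexDeriv hα hΩ hd hp₀).norm).mono_left nhdsWithin_le_nhds

/-- A positive limit l gives the bounds l/2 and 2l near each point, and compactness makes them
uniform. The bounds are confined to R_g because on S_g the formula for λ returns 0: either |x|^α = 0
or the division is by 0. -/
theorem exists_bounds_conformalFactor {K : Set (ℝ × ℝ)} (hK : IsCompact K) (hα : 0 < α)
    (hlim : ∀ p₀ ∈ K, ∃ l : ℝ, 0 < l ∧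
      Tendsto (conformalFactor hα g) (𝓝[regularSet Ω g] p₀) (𝓝 l)) :
    ∃ C₁ C₂ : ℝ, 0 < C₁ ∧ 0 < C₂ ∧ ∀ p ∈ K ∩ regularSet Ω g,
      C₁ ≤ conformalFactor hα g p ∧ conformalFactor hα g p ≤ C₂ := by
  refine hK.induction_on (p := fun s => ∃ C₁ C₂ : ℝ, 0 < C₁ ∧ 0 < C₂ ∧ ∀ p ∈ s ∩ regularSet Ω g,
      C₁ ≤ conformalFactor hα g p ∧ conformalFactor hα g p ≤ C₂) ?_ ?_ ?_ ?_
  · exact ⟨1, 1, one_pos, one_pos, by simp⟩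
  · rintro s t hst ⟨C₁, C₂, h₁, h₂, h⟩
    exact ⟨C₁, C₂, h₁, h₂, fun p hp => h p ⟨hst hp.1, hp.2⟩⟩
  · rintro s t ⟨C₁, C₂, h₁, h₂, h⟩ ⟨C₃, C₄, h₃, h₄, h'⟩
    refine ⟨min C₁ C₃, max C₂ C₄, lt_min h₁ h₃, lt_max_of_lt_left h₂, ?_⟩
    rintro p ⟨hp | hp, hpR⟩
    · exact ⟨(min_le_left _ _).trans (h p ⟨hp, hpR⟩).1, (h p ⟨hp, hpR⟩).2.trans (le_max_left _ _)⟩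
    · exact ⟨(min_le_right _ _).trans (h' p ⟨hp, hpR⟩).1,
        (h' p ⟨hp, hpR⟩).2.trans (le_max_right _ _)⟩
  · intro p₀ hp₀
    obtain ⟨l, hl, ht⟩ := hlim p₀ hp₀
    have h1 := (ht.eventually_const_le (half_lt_self hl)).and
      (ht.eventually_le_const (show l < 2 * l by linarith))
    rw [eventually_nhdsWithin_iff] at h1
    exact ⟨_, mem_nhdsWithin_of_mem_nhds h1, l / 2, 2 * l, by positivity, by positivity,
      fun p hp => hp.1 hp.2⟩

end Grushin

/-! ### Lipschitz continuity across the singular line. -/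

/-- The mean value theorem applies on each side of 0; continuity joins the two estimates there. -/
theorem abs_sub_le_of_abs_deriv_le_off_zero {k : ℝ → ℝ} {s : Set ℝ} (hs : s.OrdConnected) {M : ℝ}
    (hk : ContinuousOn k s)
    (hd : ∀ x ∈ s, x ≠ 0 → ∃ k', |k'| ≤ M ∧ HasDerivAt k k' x) {u w : ℝ} (hu : u ∈ s)
    (hw : w ∈ s) : |k w - k u| ≤ M * |w - u| := by
  have base : ∀ {u w : ℝ}, u ∈ s → w ∈ s → u ≤ w → (0 : ℝ) ∉ Ioo u w →
      |k w - k u| ≤ M * (w - u) := by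
    intro u w hu hw huw h0
    rcases huw.eq_or_lt with rfl | hlt
    · simp
    · have hsub : Icc u w ⊆ s := hs.out hu hw
      obtain ⟨x, hx, hxe⟩ := exists_deriv_eq_slope k hlt (hk.mono hsub) fun x hx => by
        obtain ⟨k', -, h⟩ := hd x (hsub (Ioo_subset_Icc_self hx)) (ne_of_mem_of_not_mem hx h0)
        exact h.differentiableAt.differentiableWithinAt
      obtain ⟨k', hk', h⟩ := hd x (hsub (Ioo_subset_Icc_self hx)) (ne_of_mem_of_not_mem hx h0)
      rw [h.deriv, eq_div_iff (sub_pos.2 hlt).ne'] at hxe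
      rw [← hxe, abs_mul, abs_of_pos (sub_pos.2 hlt)]
      exact mul_le_mul_of_nonneg_right hk' (sub_pos.2 hlt).le
  have main : ∀ {u w : ℝ}, u ∈ s → w ∈ s → u ≤ w → |k w - k u| ≤ M * (w - u) := by
    intro u w hu hw huw
    by_cases h0 : (0 : ℝ) ∈ Ioo u w
    · have h0s : (0 : ℝ) ∈ s := hs.out hu hw (Ioo_subset_Icc_self h0)
      have h1 := base hu h0s h0.1.le (fun h => lt_irrefl _ h.2)
      have h2 := base h0s hw h0.2.le (fun h => lt_irrefl _ h.1)
      have := abs_sub_le (k w) (k 0) (k u)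
      linarith
    · exact base hu hw huw h0
  rcases le_total u w with h | h
  · rw [abs_of_nonneg (sub_nonneg.2 h)]; exact main hu hw h
  · rw [abs_sub_comm, abs_sub_comm w u, abs_of_nonneg (sub_nonneg.2 h)]; exact main hw hu h

/-- A continuous function that vanishes on the line `x = 0` and has bounded partial derivatives off
this line is Lipschitz. -/
theorem lipschitzOnWith_of_partials_le {k : ℝ × ℝ → ℝ} {p₀ : ℝ × ℝ} {r : ℝ} {M : NNReal}
    (hk : ContinuousOn k (Metric.ball p₀ r))
    (h0 : ∀ p ∈ Metric.ball p₀ r, p.1 = 0 → k p = 0)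
    (hd : ∀ p ∈ Metric.ball p₀ r, p.1 ≠ 0 → ∃ A B : ℝ, |A| ≤ M ∧ |B| ≤ M ∧
      HasDerivAt (fun s => k (s, p.2)) A p.1 ∧ HasDerivAt (fun s => k (p.1, s)) B p.2) :
    LipschitzOnWith (2 * M) k (Metric.ball p₀ r) := by
  have hball : Metric.ball p₀ r = Metric.ball p₀.1 r ×ˢ Metric.ball p₀.2 r :=
    (ball_prod_same p₀.1 p₀.2 r).symm
  have hoc : ∀ x : ℝ, (Metric.ball x r).OrdConnected := fun x => by
    rw [Real.ball_eq_Ioo]; exact ordConnected_Ioo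
  rw [hball] at hk h0 hd ⊢
  refine LipschitzOnWith.of_dist_le_mul fun p hp q hq => ?_
  -- The path turns at (q.1, p.2). Its vertical leg lies either off the singular line or in it,
  -- where k is 0.
  have hqp : (q.1, p.2) ∈ Metric.ball p₀.1 r ×ˢ Metric.ball p₀.2 r := ⟨hq.1, hp.2⟩
  have e1 : |k (p.1, p.2) - k (q.1, p.2)| ≤ M * |p.1 - q.1| := by
    refine abs_sub_le_of_abs_deriv_le_off_zero (k := fun s => k (s, p.2)) (hoc p₀.1) ?_ ?_
      hq.1 hp.1
    · exact hk.comp (by fun_prop) fun x hx => ⟨hx, hp.2⟩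
    · intro x hx hx0
      obtain ⟨A, B, hA, -, hAd, -⟩ := hd (x, p.2) ⟨hx, hp.2⟩ hx0
      exact ⟨A, hA, hAd⟩
  have e2 : |k (q.1, p.2) - k (q.1, q.2)| ≤ M * |p.2 - q.2| := by
    by_cases hq0 : q.1 = 0
    · rw [h0 _ hqp hq0, h0 (q.1, q.2) hq hq0, sub_zero, abs_zero]
      positivity
    · refine abs_sub_le_of_abs_deriv_le_off_zero (k := fun s => k (q.1, s)) (hoc p₀.2) ?_ ?_
        hq.2 hp.2
      · exact hk.comp (by fun_prop) fun x hx => ⟨hq.1, hx⟩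
      · intro y hy _
        obtain ⟨A, B, -, hB, -, hBd⟩ := hd (q.1, y) ⟨hq.1, hy⟩ hq0
        exact ⟨B, hB, hBd⟩
  have d1 : |p.1 - q.1| ≤ dist p q := by
    rw [← Real.dist_eq]; exact le_max_left _ _
  have d2 : |p.2 - q.2| ≤ dist p q := by
    rw [← Real.dist_eq]; exact le_max_right _ _
  have hM0 : (0 : ℝ) ≤ M := M.2
  calc dist (k p) (k q) = |k (p.1, p.2) - k (q.1, q.2)| := Real.dist_eq _ _
    _ ≤ |k (p.1, p.2) - k (q.1, p.2)| + |k (q.1, p.2) - k (q.1, q.2)| := abs_sub_le _ _ _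
    _ ≤ M * dist p q + M * dist p q :=
        add_le_add (e1.trans (mul_le_mul_of_nonneg_left d1 hM0))
          (e2.trans (mul_le_mul_of_nonneg_left d2 hM0))
    _ = (2 * M : NNReal) * dist p q := by push_cast; ring

namespace Grushin

variable {α : ℝ} {Ω Ω' : Set (ℝ × ℝ)} {g : ℝ × ℝ → ℝ × ℝ}

/-- F maps the imaginary axis into itself locally, so Re(iF') = -Im F' vanishes on it. -/
theorem im_complexDeriv_eq_zero (hα : 0 < α) (hΩ : IsOpen Ω)
    (hd : DifferentiableOn ℂ (complexConj hα g) (toComplex hα '' Ω))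
    (h0 : ∀ p ∈ Ω, p.1 = 0 → (g p).1 = 0) {y : ℝ} (hp : ((0 : ℝ), y) ∈ Ω) :
    (complexDeriv hα g (0, y)).im = 0 := by
  have h1 := (hasStrictFDerivAt_toComplex_comp hα hΩ hd hp).hasFDerivAt
  have h2 : HasDerivAt (fun s : ℝ => ((0 : ℝ), s)) ((0 : ℝ), (1 : ℝ)) y :=
    (hasDerivAt_const _ _).prodMk (hasDerivAt_id _)
  have h3 := Complex.reCLM.hasFDerivAt.comp_hasDerivAt y (h1.comp_hasDerivAt y h2)
  have h4 : HasDerivAt (Complex.reCLM ∘ (fun q => toComplex hα (g q)) ∘ fun s : ℝ => ((0 : ℝ), s))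
      0 y := by
    refine (hasDerivAt_const y (0 : ℝ)).congr_of_eventuallyEq ?_
    have : ∀ᶠ s : ℝ in 𝓝 y, ((0 : ℝ), s) ∈ Ω :=
      h2.continuousAt.preimage_mem_nhds (hΩ.mem_nhds hp)
    filter_upwards [this] with s hs
    simp [toComplex_apply, h0 _ hs rfl, flatten_zero]
  have := h3.unique h4
  simpa using this

/-- Near a point of the singular line `g` is Lipschitz: the factor `|x|` in `∂_y g₁` compensates the
degeneracy of the structure. -/
theorem exists_lipschitzOnWith_fst_of_fst_eq_zero (hα : 0 < α) (hΩ : IsOpen Ω)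
    (hg : ContinuousOn g Ω)
    (hd : DifferentiableOn ℂ (complexConj hα g) (toComplex hα '' Ω))
    (hne : ∀ p ∈ Ω, complexDeriv hα g p ≠ 0)
    (h0 : ∀ p ∈ Ω, p.1 = 0 → (g p).1 = 0) (h0' : ∀ p ∈ Ω, p.1 ≠ 0 → (g p).1 ≠ 0)
    {p₀ : ℝ × ℝ} (hp₀ : p₀ ∈ Ω) (hx₀ : p₀.1 = 0) {l : ℝ}
    (hl : Tendsto (conformalFactor hα g) (𝓝[regularSet Ω g] p₀) (𝓝 l)) :
    ∃ K : NNReal, ∃ t ∈ 𝓝 p₀, LipschitzOnWith K (fun p => (g p).1) t := by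
  have hDopen := isOpen_image_toComplex hα hΩ
  -- K is a local Lipschitz constant of F', which is itself holomorphic.
  obtain ⟨K, V, hV, hK⟩ := (hd.analyticAt (hDopen.mem_nhds
    (mem_image_of_mem _ hp₀))).deriv.hasStrictDerivAt.hasStrictFDerivAt.exists_lipschitzOnWith
  have hlam : ∀ᶠ p in 𝓝 p₀, p ∈ regularSet Ω g → conformalFactor hα g p ≤ |l| + 1 := by
    rw [← eventually_nhdsWithin_iff]
    exact hl.eventually_le_const (by linarith [le_abs_self l])
  set m := ‖complexDeriv hα g p₀‖ / 2 with hm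
  have hnp : 0 < ‖complexDeriv hα g p₀‖ := norm_pos_iff.2 (hne p₀ hp₀)
  have hm0 : 0 < m := by positivity
  have hder : ∀ᶠ p in 𝓝 p₀, m ≤ ‖complexDeriv hα g p‖ :=
    (continuousAt_complexDeriv hα hΩ hd hp₀).norm.eventually_const_le (half_lt_self hnp)
  have hVp : ∀ᶠ p in 𝓝 p₀, toComplex hα p ∈ V :=
    (toComplex hα).continuous.continuousAt.preimage_mem_nhds hV
  obtain ⟨r, hr, hball⟩ := Metric.eventually_nhds_iff_ball.1
    (hlam.and (hder.and (hVp.and (hΩ.mem_nhds hp₀))))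
  -- The first summand bounds ∂_x g₁ through λ; the second bounds ∂_y g₁ through |Im F'| ≤
  -- K|x||x|^α, |x| ≤ r and |x|^α/|g₁|^α ≤ (|l| + 1)/m.
  set M : NNReal := Real.toNNReal ((|l| + 1) + K * r * ((|l| + 1) / m)) with hMdef
  have hMc : (M : ℝ) = (|l| + 1) + K * r * ((|l| + 1) / m) := Real.coe_toNNReal _ (by positivity)
  refine ⟨2 * M, Metric.ball p₀ r, Metric.ball_mem_nhds _ hr, ?_⟩
  have hΩb : Metric.ball p₀ r ⊆ Ω := fun p hp => (hball p hp).2.2.2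
  refine lipschitzOnWith_of_partials_le (continuous_fst.comp_continuousOn (hg.mono hΩb))
    (fun p hp => h0 p (hΩb hp)) fun p hp hpx => ?_
  obtain ⟨hp1, hp2, hp3, hpΩ⟩ := hball p hp
  have hgp := h0' p hpΩ hpx
  obtain ⟨hA, hB⟩ := hasDerivAt_partials_of_hasFDerivAt
    (hasStrictFDerivAt_fst_map hα hΩ hd hpΩ hgp).hasFDerivAt
  have hX : 0 < |p.1| ^ α := Real.rpow_pos_of_pos (abs_pos.2 hpx) _
  have hG : 0 < |(g p).1| ^ α := Real.rpow_pos_of_pos (abs_pos.2 hgp) _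
  have hlamp := hp1 ⟨hpΩ, fun hS => hS.2.elim hpx hgp⟩
  have hmu : |p.1| ^ α / |(g p).1| ^ α ≤ (|l| + 1) / m := by
    rw [le_div_iff₀ hm0]
    exact (mul_le_mul_of_nonneg_left hp2 (by positivity)).trans hlamp
  have hq : ((0 : ℝ), p.2) ∈ Metric.ball p₀ r := by
    rw [Metric.mem_ball, Prod.dist_eq] at hp ⊢
    simp only [hx₀, dist_self]
    exact max_lt hr ((le_max_right _ _).trans_lt hp)
  have him : |(complexDeriv hα g p).im| ≤ K * (|p.1| * |p.1| ^ α) := by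
    have e0 := im_complexDeriv_eq_zero hα hΩ hd h0 (hΩb hq)
    have e1 := hK.dist_le_mul _ hp3 _ (hball _ hq).2.2.1
    rw [dist_eq_norm, dist_eq_norm] at e1
    have e2 : toComplex hα p - toComplex hα (0, p.2) = (flatten α p.1 : ℝ) := by
      rw [toComplex_apply, toComplex_apply]
      apply Complex.ext <;> simp [flatten_zero]
    rw [e2, Complex.norm_real, Real.norm_eq_abs] at e1
    calc |(complexDeriv hα g p).im|
        = |(complexDeriv hα g p - complexDeriv hα g (0, p.2)).im| := by
          rw [Complex.sub_im, e0, sub_zero]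
      _ ≤ ‖complexDeriv hα g p - complexDeriv hα g (0, p.2)‖ := Complex.abs_im_le_norm _
      _ ≤ K * |flatten α p.1| := e1
      _ ≤ _ := mul_le_mul_of_nonneg_left (abs_flatten_le hα p.1) K.2
  have hxr : |p.1| ≤ r := by
    have : dist p.1 p₀.1 < r := (le_max_left _ _).trans_lt (Metric.mem_ball.1 hp)
    rw [hx₀, Real.dist_eq, sub_zero] at this
    exact this.le
  refine ⟨_, _, ?_, ?_, hA, hB⟩
  · rw [hMc, abs_mul, abs_of_pos (div_pos hX hG)]
    have h1 : |p.1| ^ α / |(g p).1| ^ α * |(complexDeriv hα g p).re| ≤ |l| + 1 :=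
      (mul_le_mul_of_nonneg_left (Complex.abs_re_le_norm _) (by positivity)).trans hlamp
    have h2 : 0 ≤ K * r * ((|l| + 1) / m) := by positivity
    linarith
  · rw [hMc, abs_div, abs_neg, abs_of_pos hG]
    calc |(complexDeriv hα g p).im| / |(g p).1| ^ α
        ≤ K * (|p.1| * |p.1| ^ α) / |(g p).1| ^ α := by gcongr
      _ = K * |p.1| * (|p.1| ^ α / |(g p).1| ^ α) := by ring
      _ ≤ K * r * ((|l| + 1) / m) := by gcongr
      _ ≤ _ := by linarith [abs_nonneg l]

theorem locallyLipschitzOn_of_conformal (hα : 0 < α) (hΩ : IsOpen Ω)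
    (hg : ContinuousOn g Ω)
    (hd : DifferentiableOn ℂ (complexConj hα g) (toComplex hα '' Ω))
    (hne : ∀ p ∈ Ω, complexDeriv hα g p ≠ 0)
    (h0 : ∀ p ∈ Ω, p.1 = 0 → (g p).1 = 0) (h0' : ∀ p ∈ Ω, p.1 ≠ 0 → (g p).1 ≠ 0)
    (hl : ∀ p ∈ Ω, ∃ l : ℝ, 0 < l ∧
      Tendsto (conformalFactor hα g) (𝓝[regularSet Ω g] p) (𝓝 l)) :
    LocallyLipschitzOn Ω g := by
  intro p hp
  obtain ⟨K₂, t₂, ht₂, h₂⟩ := (hasStrictFDerivAt_snd_map hα hΩ hd hp).exists_lipschitzOnWith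
  obtain ⟨K₁, t₁, ht₁, h₁⟩ : ∃ K : NNReal, ∃ t ∈ 𝓝 p, LipschitzOnWith K (fun p => (g p).1) t := by
    by_cases hx : p.1 = 0
    · obtain ⟨l, -, hl⟩ := hl p hp
      exact exists_lipschitzOnWith_fst_of_fst_eq_zero hα hΩ hg hd hne h0 h0' hp hx hl
    · exact (hasStrictFDerivAt_fst_map hα hΩ hd hp (h0' p hp hx)).exists_lipschitzOnWith
  exact ⟨max K₁ K₂, t₁ ∩ t₂, mem_nhdsWithin_of_mem_nhds (inter_mem ht₁ ht₂),
    (h₁.mono inter_subset_left).prodMk (h₂.mono inter_subset_right)⟩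

/-! ### Lengths of curves. -/

theorem speed_eq {γ : ℝ → ℝ × ℝ} {t u v : ℝ} (hγ : HasDerivAt γ (u, v) t) (hx : (γ t).1 ≠ 0) :
    speed α γ t = ENNReal.ofReal (u ^ 2 + v ^ 2 / (|(γ t).1| ^ α) ^ 2) ^ (1 / 2 : ℝ) := by
  have hX : 0 < |(γ t).1| ^ α := Real.rpow_pos_of_pos (abs_pos.2 hx) _
  have h2 : |(γ t).1| ^ (2 * α) = (|(γ t).1| ^ α) ^ 2 := by
    rw [mul_comm, Real.rpow_mul (abs_nonneg _)]; norm_cast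
  rw [speed, hγ.deriv, h2, ← ENNReal.ofReal_div_of_pos (by positivity),
    ← ENNReal.ofReal_add (by positivity) (by positivity)]

/-- In the Grushin orthonormal frames the differential of g is λ times a rotation. -/
theorem speed_comp (hα : 0 < α) (hΩ : IsOpen Ω)
    (hd : DifferentiableOn ℂ (complexConj hα g) (toComplex hα '' Ω)) {γ : ℝ → ℝ × ℝ} {t : ℝ}
    (hγ : DifferentiableAt ℝ γ t) (ht : γ t ∈ regularSet Ω g) :
    speed α (g ∘ γ) t = ENNReal.ofReal (conformalFactor hα g (γ t)) * speed α γ t := by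
  obtain ⟨hx, hg0⟩ := ne_zero_of_mem_regularSet ht
  have hX : 0 < |(γ t).1| ^ α := Real.rpow_pos_of_pos (abs_pos.2 hx) _
  have hG : 0 < |(g (γ t)).1| ^ α := Real.rpow_pos_of_pos (abs_pos.2 hg0) _
  obtain ⟨u, v, huv⟩ : ∃ u v, deriv γ t = (u, v) := ⟨_, _, rfl⟩
  have hγ' : HasDerivAt γ (u, v) t := huv ▸ hγ.hasDerivAt
  have h1 := (hasStrictFDerivAt_fst_map hα hΩ hd ht.1 hg0).hasFDerivAt.comp_hasDerivAt t hγ'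
  have h2 := (hasStrictFDerivAt_snd_map hα hΩ hd ht.1).hasFDerivAt.comp_hasDerivAt t hγ'
  have h3 : HasDerivAt (g ∘ γ) _ t := h1.prodMk h2
  rw [speed_eq h3 hg0, speed_eq hγ' hx]
  have hc : 0 ≤ conformalFactor hα g (γ t) := by unfold conformalFactor; positivity
  have hs : ENNReal.ofReal (conformalFactor hα g (γ t)) =
      ENNReal.ofReal (conformalFactor hα g (γ t) ^ 2) ^ (1 / 2 : ℝ) := by
    rw [ENNReal.ofReal_rpow_of_nonneg (sq_nonneg _) (by norm_num), ← Real.sqrt_eq_rpow,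
      Real.sqrt_sq hc]
  rw [hs, ← ENNReal.mul_rpow_of_nonneg _ _ (by norm_num), ← ENNReal.ofReal_mul (sq_nonneg _)]
  congr 2
  rw [conformalFactor, mul_pow, Complex.sq_norm, Complex.normSq_apply]
  simp
  field_simp
  ring

theorem ae_differentiableAt_of_absolutelyContinuous {γ : ℝ → ℝ × ℝ} {a b : ℝ} (hab : a ≤ b)
    (hγ : AbsolutelyContinuousOnInterval γ a b) :
    ∀ᵐ t : ℝ, t ∈ Icc a b → DifferentiableAt ℝ γ t := by
  rw [← uIcc_of_le hab]
  exact hγ.boundedVariationOn.ae_differentiableAt_of_mem_uIcc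

end Grushin

theorem mainTheorem5 (α : ℝ) (hα : 0 < α) (Ω Ω' : Set (ℝ × ℝ))
    (hΩ : IsOpen Ω) (hΩc : IsConnected Ω) (hΩ' : IsOpen Ω') (hΩ'c : IsConnected Ω')
    (g : ℝ × ℝ → ℝ × ℝ)
    (hg : Grushin.MemHWMap α (2 * (α + 1) / α) Ω Ω' g)
    (hconf : Grushin.IsConformal α Ω Ω' g)
    (horient : Grushin.OrientationPreserving α Ω Ω' g)
    (U : Set (ℝ × ℝ)) (hU : Grushin.CompactlyContained U Ω) :
    ∃ C₁ C₂ : ℝ, 0 < C₁ ∧ 0 < C₂ ∧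
      ∀ (a b : ℝ) (γ : ℝ → ℝ × ℝ), a ≤ b →
        AbsolutelyContinuousOnInterval γ a b →
        MapsTo γ (Icc a b) U →
        (∀ᵐ t : ℝ, t ∈ Ioo a b → deriv γ t ≠ 0) →
        (∀ᵐ t : ℝ, t ∈ Icc a b → (γ t).1 ≠ 0) →
          AbsolutelyContinuousOnInterval (g ∘ γ) a b ∧
          ENNReal.ofReal C₁ * Grushin.length α a b γ ≤ Grushin.length α a b (g ∘ γ) ∧
          Grushin.length α a b (g ∘ γ) ≤ ENNReal.ofReal C₂ * Grushin.length α a b γ := by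
  have hd := Grushin.differentiableOn_complexConj hα hΩ hg hconf horient
  have hne : ∀ p ∈ Ω, Grushin.complexDeriv hα g p ≠ 0 := fun p hp =>
    Grushin.deriv_complexConj_ne_zero hα hΩ hg hconf horient hp
  have hgc := hconf.continuousOn
  have hS : ∀ p ∈ Grushin.singularSet Ω g, p.1 = 0 ∧ (g p).1 = 0 := fun p hp =>
    Grushin.fst_eq_zero_of_mem_singularSet hα hΩ hgc horient.2 hconf.limit hd hne hp
  have h0 : ∀ p ∈ Ω, p.1 = 0 → (g p).1 = 0 := fun p hp h => (hS p ⟨hp, Or.inl h⟩).2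
  have h0' : ∀ p ∈ Ω, p.1 ≠ 0 → (g p).1 ≠ 0 := fun p hp h h' => h (hS p ⟨hp, Or.inr h'⟩).1
  have hl : ∀ p ∈ Ω, ∃ l : ℝ, 0 < l ∧ Tendsto (Grushin.conformalFactor hα g)
      (𝓝[Grushin.regularSet Ω g] p) (𝓝 l) := fun p hp =>
    Grushin.exists_tendsto_conformalFactor hα hΩ hgc horient.2 hconf.limit hd hne hp
  obtain ⟨K, hK⟩ := ((Grushin.locallyLipschitzOn_of_conformal hα hΩ hgc hd hne h0 h0' hl).mono
    hU.2).exists_lipschitzOnWith_of_compact hU.1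
  obtain ⟨C₁, C₂, hC₁, hC₂, hC⟩ := Grushin.exists_bounds_conformalFactor hU.1 hα
    fun p hp => hl p (hU.2 hp)
  refine ⟨C₁, C₂, hC₁, hC₂, fun a b γ hab hγ hγU _ hγ0 => ?_⟩
  -- The constants come from the compact closure of U.
  have hγU' : ∀ t ∈ Icc a b, γ t ∈ closure U := fun t ht => subset_closure (hγU ht)
  have hspeed : ∀ᵐ t ∂volume.restrict (Icc a b),
      ENNReal.ofReal C₁ * Grushin.speed α γ t ≤ Grushin.speed α (g ∘ γ) t ∧
      Grushin.speed α (g ∘ γ) t ≤ ENNReal.ofReal C₂ * Grushin.speed α γ t := by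
    rw [ae_restrict_iff' measurableSet_Icc]
    filter_upwards [Grushin.ae_differentiableAt_of_absolutelyContinuous hab hγ, hγ0]
      with t ht1 ht2 ht
    have htΩ := hU.2 (hγU' t ht)
    -- Off the line x = 0 also g₁ ≠ 0, so the curve is in R_g for almost every t.
    have hreg : γ t ∈ Grushin.regularSet Ω g :=
      ⟨htΩ, fun h => h.2.elim (ht2 ht) (h0' _ htΩ (ht2 ht))⟩
    obtain ⟨hb1, hb2⟩ := hC _ ⟨hγU' t ht, hreg⟩
    rw [Grushin.speed_comp hα hΩ hd (ht1 ht) hreg]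
    exact ⟨by gcongr, by gcongr⟩
  refine ⟨hγ.lipschitzOnWith_comp hK (by rwa [uIcc_of_le hab]), ?_, ?_⟩
  · rw [Grushin.length, Grushin.length, ← lintegral_const_mul' _ _ ENNReal.ofReal_ne_top]
    exact lintegral_mono_ae (hspeed.mono fun t h => h.1)
  · rw [Grushin.length, Grushin.length, ← lintegral_const_mul' _ _ ENNReal.ofReal_ne_top]
    exact lintegral_mono_ae (hspeed.mono fun t h => h.2)
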